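/- \textbf{Setting.} Consider an MDP with horizon $T$, steps $t=0,\dots,T-1$, transition kernels and rewards that are linear in a known measurable feature map $\phi:\mathcal S\times\mathcal A\to\mathbb R^d$, $\|\phi\|_2\le 1$: $\mathbb P_t(B\mid s,a)=\langle\mu_t(B),\phi(s,a)\rangle$ with unknown (signed) measures $\mu_t$, and $r_t(s,a)=\langle\upsilon_t,\phi(s,a)\rangle\in[0,1]$. At every step $t$, $m$ offline transitions and then $k$ online (fine-tuning) transitions $(s_t^i,a_t^i,s_{t+1}^i)$ are recorded, the next state of transition $i$ being drawn from $\mathbb P_t(\cdot\mid s_t^i,a_t^i)$ given $(s^i_t,a^i_t)$ and the transitions recorded at step $t$ in earlier trajectories. To each transition a finite list $B_t^i$ of adversarial states is attached, and to both phases finite lists of OOD samples $(\hat s,\hat a,\hat y)$; these lists are arbitrary and may depend on all the data. For the data $\mathcal D$ of step $t$ put $$\Lambda_t(\mathcal D)=\sum_i\phi(s_t^i,a_t^i)\phi(s_t^i,a_t^i)^\top+\sum_{\rm ood}\phi(\hat s,\hat a)\phi(\hat s,\hat a)^\top+\sum_i\frac1{|B_t^i|}\sum_{\hat s\in B_t^i}[\phi(\hat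 s,a_t^i)-\phi(s_t^i,a_t^i)][\phi(\hat s,a_t^i)-\phi(s_t^i,a_t^i)]^\top,$$ $U_t(s,a;\mathcal D)=[\phi(s,a)^\top\Lambda_t(\mathcal D)^{-1}\phi(s,a)]^{1/2}$ and $\Gamma^{\rm lcb}(s_t,a_t;\mathcal D)=\beta_t\,U_t(s_t,a_t;\mathcal D)$. Let $\mathcal D_{\rm RO2O}$ consist of the offline transitions with their adversarial and OOD samples, $\mathcal D_{\rm online}$ of the online ones, and $\mathcal D=\mathcal D_{\rm RO2O}\cup\mathcal D_{\rm online}$ (with multiplicity). RO2O with penalty coefficients $\alpha_t$ is run on $\mathcal D$: $\widehat V_T=0$ and, for $t=T-1,\dots,0$, $\widetilde w_t$ minimizes over $w$ $$\sum_i\big(r_t(s_t^i,a_t^i)+\widehat V_{t+1}(s_{t+1}^i)-\phi(s_t^i,a_t^i)^\top w\big)^2+\sum_{\rm ood}\big(\hat y-\phi(\hat s,\hat a)^\top w\big)^2+\sum_i\frac1{|B_t^i|}\sum_{\hat s\in B_t^i}\big(\phi(s_t^i,a_t^i)^\top w-\phi(\hat s,a_t^i)^\top w\big)^2,$$ $\widehat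 Q_t=\max\{0,\min\{T-t,\ \phi^\top\widetilde w_t-\alpha_tU_t(\cdot;\mathcal D)\}\}$, $\widetilde\pi_t$ is greedy for $\widehat Q_t$, and $\widehat V_t=\max_a\widehat Q_t(\cdot,a)$. Let $\mathcal T_tV(s,a)=r_t(s,a)+\mathbb E[V(s')\mid s,a]$. For a constant $c$ define the confidence width $$b_t=c\,dT\sqrt{\log\frac{2dTN(1+\sum_\tau\alpha_\tau)(1+1/\lambda)}{\xi}}+\Big(\sum_{\rm ood}(\hat y-\mathcal T_t\widehat V_{t+1}(\hat s,\hat a))^2\Big)^{1/2}+\Big(\sum_i\frac1{|B_t^i|}\sum_{\hat s\in B_t^i}\big(\mathcal T_t\widehat V_{t+1}(\hat s,a_t^i)-\mathcal T_t\widehat V_{t+1}(s_t^i,a_t^i)\big)^2\Big)^{1/2},$$ where $N$ is $m+k$ plus the total number of OOD samples over all steps, and $\lambda$ is the smallest of the eigenvalues of $\Lambda_t(\mathcal D)$, $t<T$. \textbf{Theorem.} There is a universal constant $c>0$ such that, for every $\xi\in(0,1)$, the following holds with probability at least $1-\xi$ over the recorded transitions, simultaneously for all choices of the adversarial and OOD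 samples for which $\Lambda_t(\mathcal D_{\rm RO2O})$ is positive definite for all $t<T$, all coefficients with $b_t\le\alpha_t$ and $\alpha_t+b_t\le\beta_t$ for all $t<T$, all initial distributions, and all policies $\pi^*$ (in particular the optimal one): $$\mathrm{SubOpt}(\pi^*,\widetilde\pi)\le\sum_{t}\mathbb E_{\pi^*}\big[\Gamma^{\rm lcb}(s_t,a_t;\mathcal D_{\rm RO2O}\cup\mathcal D_{\rm online})\big]\le\sum_{t}\mathbb E_{\pi^*}\big[\Gamma^{\rm lcb}(s_t,a_t;\mathcal D_{\rm RO2O})\big],$$ where $\mathrm{SubOpt}(\pi^*,\widetilde\pi)$ is the difference of the expected cumulative rewards of $\pi^*$ and $\widetilde\pi$ over the $T$ steps. The second inequality holds surely, for all $\beta_t\ge0$. -/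

import Mathlib

open MeasureTheory ProbabilityTheory
open scoped Matrix

noncomputable section

namespace RO2O

/-- A linear MDP with feature map `φ` into `ℝ^d`: transition kernels `P t` and rewards `r t` are
linear in `φ`, through unknown signed measures `μ t` and unknown vectors `υ t`.
The stationary case is the one where `P`, `r`, `μ`, `υ` do not depend on the step `t`. -/
structure LinearMDP (S A : Type*) [MeasurableSpace S] [MeasurableSpace A] (d : ℕ) where
  φ : S × A → Fin d → ℝ
  P : ℕ → Kernel (S × A) S
  r : ℕ → S × A → ℝ
  μ : ℕ → Fin d → SignedMeasure S
  υ : ℕ → Fin d → ℝ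
  markov : ∀ t, IsMarkovKernel (P t)
  measurable_φ : Measurable φ
  /-- The Euclidean norm of every feature vector is at most one. -/
  φ_norm_le : ∀ x, φ x ⬝ᵥ φ x ≤ 1
  r_mem : ∀ t x, r t x ∈ Set.Icc (0 : ℝ) 1
  P_eq : ∀ t x (B : Set S), MeasurableSet B → (P t x).real B = ∑ j, φ x j * μ t j B
  r_eq : ∀ t x, r t x = υ t ⬝ᵥ φ x

/-- An observed transition `(s, a, s')`, together with the finite list `adv` of adversarial
(perturbed) states sampled around `s` for the smoothness term. -/
structure Sample (S A : Type*) where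
  s : S
  a : A
  s' : S
  adv : List S

/-- The data available at one step: transitions with their adversarial states, and OOD samples
`(ŝ, â, ŷ)` with their regression targets `ŷ`. -/
structure StepData (S A : Type*) where
  samples : List (Sample S A)
  ood : List (S × A × ℝ)

/-- Union (with multiplicity) of two data sets. -/
def StepData.union {S A : Type*} (D D' : StepData S A) : StepData S A :=
  ⟨D.samples ++ D'.samples, D.ood ++ D'.ood⟩

/-- The data set at one step built from the recorded transitions `z i` for `i` in `I`, the
adversarial states `adv i`, and the OOD samples `ood`. -/
def mkData {S A : Type*} (I : List ℕ) (z : ℕ → S × A × S) (adv : ℕ → List S)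
    (ood : List (S × A × ℝ)) : StepData S A :=
  ⟨I.map fun i => ⟨(z i).1, (z i).2.1, (z i).2.2, adv i⟩, ood⟩

section Learner

variable {S A : Type*} [MeasurableSpace S] [MeasurableSpace A] {d : ℕ}

/-- Covariance of the in-distribution samples. -/
def covIn (M : LinearMDP S A d) (D : StepData S A) : Matrix (Fin d) (Fin d) ℝ :=
  (D.samples.map fun z => Matrix.vecMulVec (M.φ (z.s, z.a)) (M.φ (z.s, z.a))).sum

/-- Covariance of the OOD samples. -/
def covOod (M : LinearMDP S A d) (D : StepData S A) : Matrix (Fin d) (Fin d) ℝ :=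
  (D.ood.map fun z => Matrix.vecMulVec (M.φ (z.1, z.2.1)) (M.φ (z.1, z.2.1))).sum

/-- Covariance of the feature differences produced by the adversarial samples. -/
def covRobust (M : LinearMDP S A d) (D : StepData S A) : Matrix (Fin d) (Fin d) ℝ :=
  (D.samples.map fun z => (1 / (z.adv.length : ℝ)) •
    (z.adv.map fun sh => Matrix.vecMulVec (M.φ (sh, z.a) - M.φ (z.s, z.a))
      (M.φ (sh, z.a) - M.φ (z.s, z.a))).sum).sum

/-- The covariance matrix of RO2O. -/
def cov (M : LinearMDP S A d) (D : StepData S A) : Matrix (Fin d) (Fin d) ℝ :=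
  covIn M D + covOod M D + covRobust M D

/-- The uncertainty `[φ(s,a)ᵀ Λ⁻¹ φ(s,a)]^{1/2}` (in linear MDPs, the ensemble's standard
deviation). -/
def uncertainty (M : LinearMDP S A d) (D : StepData S A) (x : S × A) : ℝ :=
  Real.sqrt (M.φ x ⬝ᵥ ((cov M D)⁻¹ *ᵥ M.φ x))

/-- The lower-confidence-bound term `Γ^lcb(s,a;D)` with factor `β`. -/
def lcb (M : LinearMDP S A d) (β : ℝ) (D : StepData S A) (x : S × A) : ℝ :=
  β * uncertainty M D x

/-- The RO2O loss in a linear MDP at step `t`, when `V` is the estimated value function of the next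
step: TD error, OOD penalty and smoothness term. -/
def loss (M : LinearMDP S A d) (t : ℕ) (D : StepData S A) (V : S → ℝ) (w : Fin d → ℝ) : ℝ :=
  (D.samples.map fun z => (M.r t (z.s, z.a) + V z.s' - M.φ (z.s, z.a) ⬝ᵥ w) ^ 2).sum
  + (D.ood.map fun z => (z.2.2 - M.φ (z.1, z.2.1) ⬝ᵥ w) ^ 2).sum
  + (D.samples.map fun z => (1 / (z.adv.length : ℝ)) *
      (z.adv.map fun sh => (M.φ (z.s, z.a) ⬝ᵥ w - M.φ (sh, z.a) ⬝ᵥ w) ^ 2).sum).sum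

/-- Pessimistic action value at step `t` (steps are `0, …, T - 1`), truncated to the range
`[0, T - t]` of cumulative rewards. -/
def pessQ (M : LinearMDP S A d) (T t : ℕ) (α : ℝ) (D : StepData S A) (w : Fin d → ℝ)
    (x : S × A) : ℝ :=
  max 0 (min ((T : ℝ) - t) (M.φ x ⬝ᵥ w - α * uncertainty M D x))

/-- A run of RO2O in a linear MDP on the data sets `D 0, …, D (T - 1)` with uncertainty penalty
coefficients `α t`: backward in `t`, `w t` minimizes the loss with the value function `V (t + 1)`,
and `π t` is greedy for the penalized action value, whose maximum over actions is `V t`. -/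
structure Run (M : LinearMDP S A d) (T : ℕ) (D : ℕ → StepData S A) (α : ℕ → ℝ) where
  w : ℕ → Fin d → ℝ
  V : ℕ → S → ℝ
  π : ℕ → S → A
  measurable_π : ∀ t, Measurable (π t)
  terminal : ∀ s, V T s = 0
  regression : ∀ t < T, ∀ w', loss M t (D t) (V (t + 1)) (w t) ≤ loss M t (D t) (V (t + 1)) w'
  greedy : ∀ t < T, ∀ s a,
    pessQ M T t (α t) (D t) (w t) (s, a) ≤ pessQ M T t (α t) (D t) (w t) (s, π t s)
  value : ∀ t < T, ∀ s, V t s = pessQ M T t (α t) (D t) (w t) (s, π t s)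

/-- The learned policy of a run. -/
def Run.policy {M : LinearMDP S A d} {T : ℕ} {D : ℕ → StepData S A} {α : ℕ → ℝ}
    (R : Run M T D α) (t : ℕ) : Kernel S A :=
  Kernel.deterministic (R.π t) (R.measurable_π t)

/-- Law of the state at step `t` under the policy `π`, when the initial state has law `ρ`. -/
def stateLaw (M : LinearMDP S A d) (π : ℕ → Kernel S A) (ρ : Measure S) : ℕ → Measure S
  | 0 => ρ
  | t + 1 => (stateLaw M π ρ t ⊗ₘ π t).bind (M.P t)

/-- `E_π[f(s_t, a_t)]` when the initial state has law `ρ`. -/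
def expect (M : LinearMDP S A d) (π : ℕ → Kernel S A) (ρ : Measure S) (t : ℕ)
    (f : S × A → ℝ) : ℝ :=
  ∫ x, f x ∂(stateLaw M π ρ t ⊗ₘ π t)

/-- Expected cumulative (undiscounted) reward of `π` over `T` steps. -/
def totalReward (M : LinearMDP S A d) (T : ℕ) (π : ℕ → Kernel S A) (ρ : Measure S) : ℝ :=
  ∑ t ∈ Finset.range T, expect M π ρ t (M.r t)

/-- Sub-optimality gap of `π'` with respect to `π`. -/
def subOpt (M : LinearMDP S A d) (T : ℕ) (π π' : ℕ → Kernel S A) (ρ : Measure S) : ℝ :=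
  totalReward M T π ρ - totalReward M T π' ρ

/-- The true Bellman target `r_t(s,a) + E[V(s')]`. -/
def bellman (M : LinearMDP S A d) (t : ℕ) (V : S → ℝ) (x : S × A) : ℝ :=
  M.r t x + ∫ s', V s' ∂(M.P t x)

/-- Error of the OOD targets: `ℓ²` distance to the true Bellman targets. -/
def oodError (M : LinearMDP S A d) (t : ℕ) (D : StepData S A) (V : S → ℝ) : ℝ :=
  Real.sqrt (D.ood.map fun z => (z.2.2 - bellman M t V (z.1, z.2.1)) ^ 2).sum

/-- Smoothing bias: `ℓ²` size of the variation of the true Bellman target under the adversarial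
perturbations. -/
def smoothError (M : LinearMDP S A d) (t : ℕ) (D : StepData S A) (V : S → ℝ) : ℝ :=
  Real.sqrt (D.samples.map fun z => (1 / (z.adv.length : ℝ)) *
    (z.adv.map fun sh => (bellman M t V (sh, z.a) - bellman M t V (z.s, z.a)) ^ 2).sum).sum

/-- Smallest eigenvalue (as minimum of the Rayleigh quotient) among the covariance matrices of the
`T` steps. -/
def minEig (M : LinearMDP S A d) (T : ℕ) (D : ℕ → StepData S A) : ℝ :=
  sInf {q | ∃ t < T, ∃ y : Fin d → ℝ, y ⬝ᵥ y = 1 ∧ q = y ⬝ᵥ (cov M (D t) *ᵥ y)}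

/-- Confidence width at step `t` for a data set with `n` transitions per step:
`c d T √(log(2 d T N (1 + ∑ α) (1 + 1/λ) / ξ))` plus the OOD target error and the smoothing bias,
where `N` counts the transitions per step and all OOD samples, and `λ` is the smallest
eigenvalue. -/
def width (c : ℝ) (M : LinearMDP S A d) (T n : ℕ) (ξ : ℝ) (D : ℕ → StepData S A) (α : ℕ → ℝ)
    (t : ℕ) (V : S → ℝ) : ℝ :=
  c * d * T * Real.sqrt (Real.log
      (2 * d * T * (n + ∑ τ ∈ Finset.range T, ((D τ).ood.length : ℝ))
        * (1 + ∑ τ ∈ Finset.range T, α τ) * (1 + 1 / minEig M T D) / ξ))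
    + oodError M t (D t) V + smoothError M t (D t) V

end Learner

section Data

variable {S A Ω : Type*} [MeasurableSpace S] [MeasurableSpace A]

/-- Everything recorded at a fixed step in the trajectories before the `i`-th one, together with
the state and action of the `i`-th one. -/
abbrev hist (z : ℕ → Ω → S × A × S) (i : ℕ) : MeasurableSpace Ω :=
  (⨆ j, ⨆ _ : j < i, MeasurableSpace.comap (z j) inferInstance) ⊔
    MeasurableSpace.comap (fun ω => ((z i ω).1, (z i ω).2.1)) inferInstance

/-- The transitions `Z t i = (s_t^i, a_t^i, s_{t+1}^i)`, `t < T`, `i < n`, were collected in the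
MDP: given the past, the next state is drawn from the transition kernel. The behaviour policies are
arbitrary and may depend on earlier trajectories. -/
structure Collected [MeasurableSpace Ω] {d : ℕ} (M : LinearMDP S A d) (Pr : Measure Ω) (T n : ℕ)
    (Z : ℕ → ℕ → Ω → S × A × S) : Prop where
  measurable : ∀ t < T, ∀ i < n, Measurable (Z t i)
  next : ∀ t < T, ∀ i < n, ∀ B : Set S, MeasurableSet B →
    Pr[((fun ω => (Z t i ω).2.2) ⁻¹' B).indicator (fun _ => (1 : ℝ)) | hist (Z t) i]
      =ᵐ[Pr] fun ω => (M.P t ((Z t i ω).1, (Z t i ω).2.1)).real B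

end Data

end RO2O

end

/-! The proof has a deterministic and a statistical half.

Deterministic half. Let `b` bound the regression error in units of the uncertainty: the fitted
linear function is within `b U` of the Bellman target of the next value estimate. Then `b ≤ α` makes
the penalized action value an underestimate of that target, and `α + b ≤ β` makes the
underestimation at most `β U`. Telescoping along the greedy policy shows that the initial value
estimate is at most its reward (`le_totalReward`); telescoping along the comparison policy shows
that its reward exceeds the estimate by at most the expected penalties (`totalReward_le`). Together
these give `subOpt_le`. The comparison of the two data sets holds because extra data add a positive
semidefinite matrix to the covariance and the inverse is antitone (`dotProduct_inv_le`).

Statistical half. The Bellman target is linear in the features, with some coefficient vector `v`,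
and the loss is a single weighted least squares problem whose Gram matrix is the covariance `Λ`.
Testing the normal equations against the error `y = w - v` itself gives `yᵀΛy` as a noise term plus
an OOD and a smoothing term; Cauchy–Schwarz bounds the last two by the two bias errors times the
`Λ`-norm of `y` (`form_error_le`). What remains is the noise in the direction `u = y / ‖y‖_Λ`, along
which the squared features of the transitions sum to at most one. For a fixed value function and
direction, an exponential supermartingale controls it (`lintegral_exp_sum_le`). The actual ones
depend on the data, but they are described by `d² + 2d` real numbers (a weight vector, the penalty
matrix `α²Λ⁻¹`, and `u`), so a union bound over a grid suffices (`sum_noise_le`) and costs a factor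
of order `d √(log K)`, where `K` is the scale of the grid.

There is no bound on these parameters in advance, because the OOD samples, adversarial states and
coefficients are chosen after the data. The good event therefore treats all sufficiently large
scales `K = 2 ^ j` at once, with summable failure probabilities (`exists_good_event`); afterwards a
scale comparable to the argument of the logarithm is selected (`exists_scale`). Only the transitions
enter the event, which gives uniformity in everything else. -/

noncomputable section

namespace RO2O

/-! ### Quadratic forms and weighted least squares -/

section LinearAlgebra

variable {d : ℕ}

theorem sq_dotProduct_le (x y : Fin d → ℝ) : (x ⬝ᵥ y) ^ 2 ≤ (x ⬝ᵥ x) * (y ⬝ᵥ y) := by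
  have := Finset.sum_mul_sq_le_sq_mul_sq Finset.univ x y
  simpa [dotProduct, pow_two] using this

theorem dotProduct_self_nonneg' (x : Fin d → ℝ) : 0 ≤ x ⬝ᵥ x :=
  Finset.sum_nonneg fun i _ => mul_self_nonneg (x i)

theorem dotProduct_mulVec_symm {Λ : Matrix (Fin d) (Fin d) ℝ} (h : Λ.IsHermitian)
    (x y : Fin d → ℝ) : x ⬝ᵥ (Λ *ᵥ y) = y ⬝ᵥ (Λ *ᵥ x) := by
  have h' : Λᵀ = Λ := by simpa [Matrix.IsHermitian] using h
  rw [Matrix.dotProduct_mulVec, ← Matrix.mulVec_transpose, h', dotProduct_comm]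

/-- Cauchy–Schwarz for a positive semidefinite form. -/
theorem sq_form_le {Λ : Matrix (Fin d) (Fin d) ℝ} (h : Λ.PosSemidef) (x y : Fin d → ℝ) :
    (x ⬝ᵥ (Λ *ᵥ y)) ^ 2 ≤ (x ⬝ᵥ (Λ *ᵥ x)) * (y ⬝ᵥ (Λ *ᵥ y)) := by
  have key : ∀ t : ℝ, 0 ≤ (x ⬝ᵥ (Λ *ᵥ x)) * (t * t) + (2 * (x ⬝ᵥ (Λ *ᵥ y))) * t
      + y ⬝ᵥ (Λ *ᵥ y) := by
    intro t
    have h0 : 0 ≤ (t • x + y) ⬝ᵥ (Λ *ᵥ (t • x + y)) := by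
      simpa using h.dotProduct_mulVec_nonneg (t • x + y)
    rw [Matrix.mulVec_add, Matrix.mulVec_smul, add_dotProduct, dotProduct_add, dotProduct_add,
      smul_dotProduct, smul_dotProduct, dotProduct_smul, dotProduct_smul,
      dotProduct_mulVec_symm h.1 y x] at h0
    simp only [smul_eq_mul] at h0
    linarith
  have := discrim_le_zero key
  unfold discrim at this
  nlinarith

theorem mulVec_inv_cancel {Λ : Matrix (Fin d) (Fin d) ℝ} (h : Λ.PosDef) (x : Fin d → ℝ) :
    Λ *ᵥ (Λ⁻¹ *ᵥ x) = x := by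
  have hu : IsUnit Λ.det := (Matrix.isUnit_iff_isUnit_det _).1 h.isUnit
  rw [Matrix.mulVec_mulVec, Matrix.mul_nonsing_inv _ hu, Matrix.one_mulVec]

theorem dotProduct_inv_mulVec {Λ : Matrix (Fin d) (Fin d) ℝ} (h : Λ.PosDef) (x : Fin d → ℝ) :
    x ⬝ᵥ (Λ⁻¹ *ᵥ x) = (Λ⁻¹ *ᵥ x) ⬝ᵥ (Λ *ᵥ (Λ⁻¹ *ᵥ x)) := by
  rw [mulVec_inv_cancel h, dotProduct_comm]

theorem dotProduct_inv_nonneg {Λ : Matrix (Fin d) (Fin d) ℝ} (h : Λ.PosDef) (x : Fin d → ℝ) :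
    0 ≤ x ⬝ᵥ (Λ⁻¹ *ᵥ x) := by
  rw [dotProduct_inv_mulVec h]
  simpa using h.posSemidef.dotProduct_mulVec_nonneg (Λ⁻¹ *ᵥ x)

/-- Cauchy–Schwarz for the form `Λ` between `Λ⁻¹ x` and `y`. With `x` a feature vector and `y` the
regression error, it converts an error in `Λ`-norm into a multiple of the uncertainty. -/
theorem abs_dotProduct_le {Λ : Matrix (Fin d) (Fin d) ℝ} (h : Λ.PosDef) (x y : Fin d → ℝ) :
    |x ⬝ᵥ y| ≤ Real.sqrt (x ⬝ᵥ (Λ⁻¹ *ᵥ x)) * Real.sqrt (y ⬝ᵥ (Λ *ᵥ y)) := by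
  rw [← Real.sqrt_mul (dotProduct_inv_nonneg h x)]
  apply Real.abs_le_sqrt
  have := sq_form_le h.posSemidef y (Λ⁻¹ *ᵥ x)
  rw [mulVec_inv_cancel h, dotProduct_comm, dotProduct_comm (Λ⁻¹ *ᵥ x)] at this
  linarith

/-- The inverse is antitone on positive definite matrices. -/
theorem dotProduct_inv_le {Λ Λ' : Matrix (Fin d) (Fin d) ℝ} (h : Λ.PosDef) (h' : Λ'.PosDef)
    (hle : ∀ y, y ⬝ᵥ (Λ *ᵥ y) ≤ y ⬝ᵥ (Λ' *ᵥ y)) (x : Fin d → ℝ) :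
    x ⬝ᵥ (Λ'⁻¹ *ᵥ x) ≤ x ⬝ᵥ (Λ⁻¹ *ᵥ x) := by
  set y := Λ'⁻¹ *ᵥ x with hy
  set z := Λ⁻¹ *ᵥ x with hz
  -- Expanded, this square is `x·z - 2 x·y + yᵀΛy`, and `yᵀΛy ≤ yᵀΛ'y = x·y`.
  have h1 : 0 ≤ (z - y) ⬝ᵥ (Λ *ᵥ (z - y)) := by
    simpa using h.posSemidef.dotProduct_mulVec_nonneg (z - y)
  have hzx : Λ *ᵥ z = x := mulVec_inv_cancel h x
  have hyx : Λ' *ᵥ y = x := mulVec_inv_cancel h' x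
  have h2 := hle y
  rw [hyx] at h2
  rw [Matrix.mulVec_sub, sub_dotProduct, dotProduct_sub, dotProduct_sub,
    dotProduct_mulVec_symm h.1 z y, hzx] at h1
  have e1 := dotProduct_comm x y
  have e2 := dotProduct_comm x z
  linarith

/-- A positive definite form is coercive. -/
theorem exists_coercive {Λ : Matrix (Fin d) (Fin d) ℝ} (h : Λ.PosDef) :
    ∃ ε > 0, ∀ y : Fin d → ℝ, y ⬝ᵥ y = 1 → ε ≤ y ⬝ᵥ (Λ *ᵥ y) := by
  have hc : IsCompact {y : Fin d → ℝ | y ⬝ᵥ y = 1} := by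
    apply Metric.isCompact_of_isClosed_isBounded
    · exact isClosed_eq (by unfold dotProduct; fun_prop) continuous_const
    · refine (Metric.isBounded_closedBall (x := (0 : Fin d → ℝ)) (r := 1)).subset ?_
      intro y hy
      rw [mem_closedBall_zero_iff, pi_norm_le_iff_of_nonneg zero_le_one]
      intro i
      have : y i * y i ≤ y ⬝ᵥ y :=
        Finset.single_le_sum (f := fun i => y i * y i) (fun i _ => mul_self_nonneg _)
          (Finset.mem_univ i)
      rw [show y ⬝ᵥ y = 1 from hy] at this
      rw [Real.norm_eq_abs]
      exact abs_le_one_iff_mul_self_le_one.2 this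
  rcases Set.eq_empty_or_nonempty {y : Fin d → ℝ | y ⬝ᵥ y = 1} with he | hne
  -- The unit sphere is empty only when `d = 0`; then any positive constant serves.
  · exact ⟨1, one_pos, fun y hy => absurd (show y ∈ {y : Fin d → ℝ | y ⬝ᵥ y = 1} from hy)
      (by rw [he]; exact Set.notMem_empty _)⟩
  · obtain ⟨y₀, hy₀, hmin⟩ := hc.exists_isMinOn hne
      (f := fun y => y ⬝ᵥ (Λ *ᵥ y)) (by unfold dotProduct Matrix.mulVec dotProduct; fun_prop)
    refine ⟨_, ?_, fun y hy => hmin hy⟩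
    have : y₀ ≠ 0 := by
      rintro rfl
      simp at hy₀
    simpa using h.dotProduct_mulVec_pos this

theorem dotProduct_self_smul_inv {y : Fin d → ℝ} (hy : y ⬝ᵥ y ≠ 0) :
    ((Real.sqrt (y ⬝ᵥ y))⁻¹ • y) ⬝ᵥ ((Real.sqrt (y ⬝ᵥ y))⁻¹ • y) = 1 := by
  have h := Real.mul_self_sqrt (dotProduct_self_nonneg' y)
  have h' : Real.sqrt (y ⬝ᵥ y) ≠ 0 := by
    intro h0; rw [h0] at h; exact hy (by linarith)
  rw [smul_dotProduct, dotProduct_smul, smul_eq_mul, smul_eq_mul]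
  field_simp
  nlinarith

theorem mul_dotProduct_self_le {Λ : Matrix (Fin d) (Fin d) ℝ} {ε : ℝ}
    (h : ∀ y : Fin d → ℝ, y ⬝ᵥ y = 1 → ε ≤ y ⬝ᵥ (Λ *ᵥ y)) (y : Fin d → ℝ) :
    ε * (y ⬝ᵥ y) ≤ y ⬝ᵥ (Λ *ᵥ y) := by
  by_cases hy : y ⬝ᵥ y = 0
  · have : y = 0 := dotProduct_self_eq_zero.1 hy
    simp [this]
  · have h1 := h _ (dotProduct_self_smul_inv hy)
    have hpos : 0 < y ⬝ᵥ y := lt_of_le_of_ne (dotProduct_self_nonneg' y) (Ne.symm hy)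
    rw [Matrix.mulVec_smul, smul_dotProduct, dotProduct_smul, smul_eq_mul, smul_eq_mul,
      ← mul_assoc, ← mul_inv, Real.mul_self_sqrt hpos.le] at h1
    rw [inv_mul_eq_div, le_div_iff₀ hpos] at h1
    exact h1

/-- The usual Cauchy–Schwarz inequality for `√w f` and `√w g`, indexed by positions because entries
of a list may repeat. -/
theorem list_sum_mul_le {ι : Type*} (l : List ι) (w f g : ι → ℝ) (hw : ∀ i, 0 ≤ w i) :
    (l.map fun i => w i * (f i * g i)).sum ≤
      Real.sqrt (l.map fun i => w i * f i ^ 2).sum * Real.sqrt (l.map fun i => w i * g i ^ 2).sum := by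
  have e : ∀ h : ι → ℝ, (l.map h).sum = ∑ i : Fin l.length, h l[i] := fun h =>
    (Fin.sum_univ_fun_getElem l h).symm
  rw [e, e, e]
  have := Real.sum_mul_le_sqrt_mul_sqrt Finset.univ (fun i : Fin l.length => Real.sqrt (w l[i]) * f l[i])
    (fun i : Fin l.length => Real.sqrt (w l[i]) * g l[i])
  simp only [mul_pow, Real.sq_sqrt (hw _)] at this
  refine le_of_eq_of_le (Finset.sum_congr rfl fun i _ => ?_) this
  rw [mul_mul_mul_comm, Real.mul_self_sqrt (hw _)]

/-- Weighted rows `(weight, regressor, target)` of a least squares problem. -/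
abbrev Row (d : ℕ) := ℝ × (Fin d → ℝ) × ℝ

def gram (l : List (Row d)) : Matrix (Fin d) (Fin d) ℝ :=
  (l.map fun z => z.1 • Matrix.vecMulVec z.2.1 z.2.1).sum

theorem dotProduct_gram (l : List (Row d)) (x y : Fin d → ℝ) :
    x ⬝ᵥ (gram l *ᵥ y) = (l.map fun z => z.1 * ((z.2.1 ⬝ᵥ x) * (z.2.1 ⬝ᵥ y))).sum := by
  induction l with
  | nil => simp [gram]
  | cons a l ih =>
    have : gram (a :: l) = a.1 • Matrix.vecMulVec a.2.1 a.2.1 + gram l := by simp [gram]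
    rw [this, Matrix.add_mulVec, dotProduct_add, ih, Matrix.smul_mulVec, Matrix.vecMulVec_mulVec]
    simp only [List.map_cons, List.sum_cons, dotProduct_smul, smul_eq_mul, op_smul_eq_smul]
    rw [dotProduct_comm x]
    ring

theorem gram_isHermitian (l : List (Row d)) : (gram l).IsHermitian := by
  induction l with
  | nil => simp [gram]
  | cons a l ih =>
    have : gram (a :: l) = a.1 • Matrix.vecMulVec a.2.1 a.2.1 + gram l := by simp [gram]
    rw [this]
    refine Matrix.IsHermitian.add ?_ ih
    ext i j
    simp [Matrix.vecMulVec, mul_comm]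

theorem gram_posSemidef (l : List (Row d)) (hl : ∀ z ∈ l, 0 ≤ z.1) : (gram l).PosSemidef := by
  refine Matrix.PosSemidef.of_dotProduct_mulVec_nonneg (gram_isHermitian l) fun x => ?_
  rw [star_trivial, dotProduct_gram]
  apply List.sum_nonneg
  intro a ha
  obtain ⟨z, hz, rfl⟩ := List.mem_map.1 ha
  exact mul_nonneg (hl z hz) (mul_self_nonneg _)

def squaredLoss (l : List (Row d)) (w : Fin d → ℝ) : ℝ :=
  (l.map fun z => z.1 * (z.2.2 - z.2.1 ⬝ᵥ w) ^ 2).sum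

theorem squaredLoss_add (l : List (Row d)) (w y : Fin d → ℝ) (ε : ℝ) :
    squaredLoss l (w + ε • y) = squaredLoss l w
      - 2 * ε * (l.map fun z => z.1 * ((z.2.2 - z.2.1 ⬝ᵥ w) * (z.2.1 ⬝ᵥ y))).sum
      + ε ^ 2 * (y ⬝ᵥ (gram l *ᵥ y)) := by
  rw [dotProduct_gram]
  unfold squaredLoss
  induction l with
  | nil => simp
  | cons a l ih =>
    simp only [List.map_cons, List.sum_cons, dotProduct_add, dotProduct_smul, smul_eq_mul] at ih ⊢
    rw [ih]
    ring

/-- The normal equations. -/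
theorem normal_equations (l : List (Row d)) {w : Fin d → ℝ}
    (h : ∀ w', squaredLoss l w ≤ squaredLoss l w') (y : Fin d → ℝ) :
    (l.map fun z => z.1 * ((z.2.2 - z.2.1 ⬝ᵥ w) * (z.2.1 ⬝ᵥ y))).sum = 0 := by
  set G := (l.map fun z => z.1 * ((z.2.2 - z.2.1 ⬝ᵥ w) * (z.2.1 ⬝ᵥ y))).sum with hG
  set q := y ⬝ᵥ (gram l *ᵥ y) with hq
  -- The loss is exactly quadratic along `y`, so minimality makes `q ε² - 2 G ε` nonnegative for
  -- every `ε`; its discriminant `4 G²` is then at most zero.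
  have key : ∀ ε : ℝ, 0 ≤ q * (ε * ε) + (-2 * G) * ε + 0 := by
    intro ε
    have := h (w + ε • y)
    rw [squaredLoss_add] at this
    linarith
  have := discrim_le_zero key
  unfold discrim at this
  nlinarith

/-- Subtracting the normal equation at `w` changes each residual at `v` into the fitted difference
`⟨regressor, w - v⟩`. This describes the error through residuals at the true coefficients without
inverting the Gram matrix. -/
theorem gram_mulVec_sub_eq (l : List (Row d)) {w : Fin d → ℝ}
    (h : ∀ w', squaredLoss l w ≤ squaredLoss l w') (v y : Fin d → ℝ) :
    y ⬝ᵥ (gram l *ᵥ (w - v)) =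
      (l.map fun z => z.1 * ((z.2.2 - z.2.1 ⬝ᵥ v) * (z.2.1 ⬝ᵥ y))).sum := by
  rw [← sub_zero ((l.map _).sum), ← normal_equations l h y, dotProduct_gram]
  clear h
  induction l with
  | nil => simp
  | cons a l ih =>
    simp only [List.map_cons, List.sum_cons, dotProduct_sub] at ih ⊢
    rw [ih]
    ring

end LinearAlgebra

/-! ### Flattening the nested sums over adversarial states -/

section AdversarialPairs

variable {S A : Type*}

/-- Pairs of a transition and one of its adversarial states. -/
def advPairs (D : StepData S A) : List (Sample S A × S) :=
  D.samples.flatMap fun z => z.adv.map fun sh => (z, sh)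

theorem advPairs_sum {X : Type*} [AddCommMonoid X] [Module ℝ X] (D : StepData S A)
    (c : Sample S A → ℝ) (f : Sample S A → S → X) :
    (D.samples.map fun z => c z • (z.adv.map fun sh => f z sh).sum).sum =
      ((advPairs D).map fun p => c p.1 • f p.1 p.2).sum := by
  unfold advPairs
  induction D.samples with
  | nil => simp
  | cons a l ih =>
    simp only [List.map_cons, List.sum_cons, List.flatMap_cons, List.map_append, List.sum_append,
      List.map_map]
    rw [ih, List.smul_sum, List.map_map]
    rfl

end AdversarialPairs

/-! ### The RO2O loss as one least squares problem; covariance, uncertainty and smallest eigenvalue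
-/

section Learner

variable {S A : Type*} [MeasurableSpace S] [MeasurableSpace A] {d : ℕ}

def inRows (M : LinearMDP S A d) (t : ℕ) (D : StepData S A) (V : S → ℝ) : List (Row d) :=
  D.samples.map fun z => (1, M.φ (z.s, z.a), M.r t (z.s, z.a) + V z.s')

def oodRows (M : LinearMDP S A d) (D : StepData S A) : List (Row d) :=
  D.ood.map fun z => (1, M.φ (z.1, z.2.1), z.2.2)

def robustRows (M : LinearMDP S A d) (D : StepData S A) : List (Row d) :=
  (advPairs D).map fun p => (1 / (p.1.adv.length : ℝ), M.φ (p.2, p.1.a) - M.φ (p.1.s, p.1.a), 0)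

/-- The smoothness term becomes regression of the target `0` on feature differences, so all three
terms of the loss share one set of normal equations. -/
def rows (M : LinearMDP S A d) (t : ℕ) (D : StepData S A) (V : S → ℝ) : List (Row d) :=
  inRows M t D V ++ oodRows M D ++ robustRows M D

theorem gram_append (l l' : List (Row d)) : gram (l ++ l') = gram l + gram l' := by
  simp [gram]

theorem gram_rows (M : LinearMDP S A d) (t : ℕ) (D : StepData S A) (V : S → ℝ) :
    gram (rows M t D V) = cov M D := by
  unfold rows cov
  rw [gram_append, gram_append]
  congr 1
  · congr 1
    · simp [gram, inRows, covIn, Function.comp_def]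
    · simp [gram, oodRows, covOod, Function.comp_def]
  · unfold covRobust
    rw [advPairs_sum D (fun z => 1 / (z.adv.length : ℝ))]
    simp [gram, robustRows, Function.comp_def]

theorem squaredLoss_rows (M : LinearMDP S A d) (t : ℕ) (D : StepData S A) (V : S → ℝ) :
    squaredLoss (rows M t D V) = loss M t D V := by
  funext w
  unfold loss
  have := advPairs_sum D (fun z => 1 / (z.adv.length : ℝ))
    (fun z sh => (M.φ (z.s, z.a) ⬝ᵥ w - M.φ (sh, z.a) ⬝ᵥ w) ^ 2)
  simp only [smul_eq_mul] at this
  rw [this]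
  simp only [squaredLoss, rows, inRows, oodRows, robustRows, List.map_append, List.sum_append,
    List.map_map, Function.comp_def, one_mul, sub_dotProduct]
  congr 4
  funext p
  ring

theorem rows_nonneg (M : LinearMDP S A d) (t : ℕ) (D : StepData S A) (V : S → ℝ) :
    ∀ z ∈ rows M t D V, 0 ≤ z.1 := by
  intro z hz
  simp only [rows, inRows, oodRows, robustRows, List.mem_append, List.mem_map] at hz
  rcases hz with (⟨_, _, rfl⟩ | ⟨_, _, rfl⟩) | ⟨_, _, rfl⟩ <;> simp

theorem cov_posSemidef (M : LinearMDP S A d) (D : StepData S A) : (cov M D).PosSemidef := by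
  -- The Gram matrix does not see the regression targets, so the step and the value function are
  -- arbitrary here.
  rw [← gram_rows M 0 D 0]
  exact gram_posSemidef _ (rows_nonneg M 0 D 0)

theorem cov_union (M : LinearMDP S A d) (D D' : StepData S A) :
    cov M (D.union D') = cov M D + cov M D' := by
  unfold cov covIn covOod covRobust StepData.union
  simp only [List.map_append, List.sum_append]
  abel

theorem cov_union_posDef (M : LinearMDP S A d) {D : StepData S A} (h : (cov M D).PosDef)
    (D' : StepData S A) : (cov M (D.union D')).PosDef := by
  rw [cov_union]
  exact h.add_posSemidef (cov_posSemidef M D')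

theorem uncertainty_union_le (M : LinearMDP S A d) {D : StepData S A} (h : (cov M D).PosDef)
    (D' : StepData S A) (x : S × A) :
    uncertainty M (D.union D') x ≤ uncertainty M D x := by
  refine Real.sqrt_le_sqrt (dotProduct_inv_le h (cov_union_posDef M h D') (fun y => ?_) _)
  rw [cov_union, Matrix.add_mulVec, dotProduct_add]
  have := (cov_posSemidef M D').dotProduct_mulVec_nonneg y
  rw [star_trivial] at this
  linarith

theorem uncertainty_nonneg (M : LinearMDP S A d) (D : StepData S A) (x : S × A) :
    0 ≤ uncertainty M D x := Real.sqrt_nonneg _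

theorem measurable_φ_apply (M : LinearMDP S A d) (i : Fin d) : Measurable fun x => M.φ x i :=
  (measurable_pi_apply i).comp M.measurable_φ

theorem measurable_uncertainty (M : LinearMDP S A d) (D : StepData S A) :
    Measurable (uncertainty M D) := by
  unfold uncertainty dotProduct Matrix.mulVec dotProduct
  have := measurable_φ_apply M
  fun_prop

theorem φ_apply_le (M : LinearMDP S A d) (x : S × A) (i : Fin d) : |M.φ x i| ≤ 1 := by
  have : M.φ x i * M.φ x i ≤ M.φ x ⬝ᵥ M.φ x :=
    Finset.single_le_sum (f := fun i => M.φ x i * M.φ x i) (fun i _ => mul_self_nonneg _)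
      (Finset.mem_univ i)
  exact abs_le_one_iff_mul_self_le_one.2 (this.trans (M.φ_norm_le x))

theorem uncertainty_bounded (M : LinearMDP S A d) (D : StepData S A) :
    ∃ C, ∀ x, uncertainty M D x ≤ C := by
  refine ⟨Real.sqrt (∑ i, ∑ j, |(cov M D)⁻¹ i j|), fun x => Real.sqrt_le_sqrt ?_⟩
  unfold dotProduct Matrix.mulVec dotProduct
  refine Finset.sum_le_sum fun i _ => ?_
  rw [Finset.mul_sum]
  refine Finset.sum_le_sum fun j _ => (le_abs_self _).trans ?_
  rw [abs_mul, abs_mul]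
  have hi := φ_apply_le M x i
  have hj := φ_apply_le M x j
  calc |M.φ x i| * (|(cov M D)⁻¹ i j| * |M.φ x j|)
      ≤ 1 * (|(cov M D)⁻¹ i j| * 1) := by gcongr
    _ = _ := by ring

/-- A common lower bound over the finitely many steps keeps the set in `minEig` bounded below, so
that its `sInf` is a genuine infimum. -/
theorem exists_minEig_lower (M : LinearMDP S A d) (T : ℕ) (D : ℕ → StepData S A)
    (h : ∀ t < T, (cov M (D t)).PosDef) :
    ∃ ε > 0, ∀ t < T, ∀ y : Fin d → ℝ, y ⬝ᵥ y = 1 → ε ≤ y ⬝ᵥ (cov M (D t) *ᵥ y) := by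
  induction T with
  | zero => exact ⟨1, one_pos, fun t ht => absurd ht (Nat.not_lt_zero _)⟩
  | succ T ih =>
    obtain ⟨ε, hε, h1⟩ := ih fun t ht => h t (ht.trans (Nat.lt_succ_self _))
    obtain ⟨ε', hε', h2⟩ := exists_coercive (h T (Nat.lt_succ_self _))
    refine ⟨min ε ε', lt_min hε hε', fun t ht y hy => ?_⟩
    rcases Nat.lt_succ_iff_lt_or_eq.1 ht with ht | rfl
    · exact (min_le_left _ _).trans (h1 t ht y hy)
    · exact (min_le_right _ _).trans (h2 y hy)

/-- Positive dimension and horizon are needed for the set of Rayleigh quotients to be nonempty;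
otherwise `sInf ∅ = 0`. -/
theorem minEig_pos [Nonempty (Fin d)] (M : LinearMDP S A d) {T : ℕ} (hT : 0 < T) (D : ℕ → StepData S A)
    (h : ∀ t < T, (cov M (D t)).PosDef) : 0 < minEig M T D := by
  obtain ⟨ε, hε, h1⟩ := exists_minEig_lower M T D h
  refine hε.trans_le (le_csInf ?_ ?_)
  · obtain ⟨i⟩ := ‹Nonempty (Fin d)›
    exact ⟨_, 0, hT, Pi.single i 1, by simp, rfl⟩
  · rintro q ⟨t, ht, y, hy, rfl⟩
    exact h1 t ht y hy

theorem minEig_mul_le (M : LinearMDP S A d) {T : ℕ} (D : ℕ → StepData S A)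
    (h : ∀ t < T, (cov M (D t)).PosDef) {t : ℕ} (ht : t < T) (y : Fin d → ℝ) :
    minEig M T D * (y ⬝ᵥ y) ≤ y ⬝ᵥ (cov M (D t) *ᵥ y) := by
  obtain ⟨ε, hε, h1⟩ := exists_minEig_lower M T D h
  have hb : BddBelow {q | ∃ t < T, ∃ y : Fin d → ℝ, y ⬝ᵥ y = 1 ∧ q = y ⬝ᵥ (cov M (D t) *ᵥ y)} := by
    refine ⟨ε, ?_⟩
    rintro q ⟨t, ht, y, hy, rfl⟩
    exact h1 t ht y hy
  exact mul_dotProduct_self_le (fun y hy => csInf_le hb ⟨t, ht, y, hy, rfl⟩) y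

end Learner

/-! ### Linearity and range of Bellman targets -/

section Bellman

/-- A setwise signed linear combination of finite measures integrates bounded functions linearly. -/
theorem integral_eq_of_real_eq {S ι : Type*} [MeasurableSpace S] [Fintype ι] (P : Measure S)
    [IsFiniteMeasure P] (p q : ι → Measure S) [∀ i, IsFiniteMeasure (p i)]
    [∀ i, IsFiniteMeasure (q i)] (a : ι → ℝ)
    (h : ∀ B, MeasurableSet B → P.real B = ∑ i, a i * ((p i).real B - (q i).real B))
    {V : S → ℝ} (hV : Measurable V) {C : ℝ} (hC : ∀ s, |V s| ≤ C) :
    ∫ s, V s ∂P = ∑ i, a i * (∫ s, V s ∂(p i) - ∫ s, V s ∂(q i)) := by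
  have hint : ∀ (ν : Measure S) [IsFiniteMeasure ν], Integrable V ν := fun ν _ =>
    Integrable.of_bound hV.aestronglyMeasurable C (Filter.Eventually.of_forall hC)
  have hsub : ∀ x : ℝ, (x.toNNReal : ℝ) - ((-x).toNNReal : ℝ) = x := fun x => by
    rw [Real.coe_toNNReal', Real.coe_toNNReal']
    rcases le_total 0 x with hx | hx
    · rw [max_eq_left hx, max_eq_right (by linarith)]; ring
    · rw [max_eq_right hx, max_eq_left (by linarith)]; ring
  -- Moving every negative contribution to the other side turns the signed identity into an equality
  -- of positive measures, against which `V` can be integrated.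
  have hm : P + ∑ i, ((-a i).toNNReal • p i + (a i).toNNReal • q i) =
      ∑ i, ((a i).toNNReal • p i + (-a i).toNNReal • q i) := by
    ext B hB
    rw [← measureReal_eq_measureReal_iff, measureReal_add_apply]
    rw [measureReal_def (∑ i, _), measureReal_def (∑ i, _), Measure.finsetSum_apply,
      Measure.finsetSum_apply, ENNReal.toReal_sum (fun _ _ => measure_ne_top _ _),
      ENNReal.toReal_sum (fun _ _ => measure_ne_top _ _), h B hB, ← Finset.sum_add_distrib]
    refine Finset.sum_congr rfl fun i _ => ?_
    rw [← measureReal_def, ← measureReal_def, measureReal_add_apply, measureReal_add_apply]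
    rw [measureReal_nnreal_smul_apply, measureReal_nnreal_smul_apply,
      measureReal_nnreal_smul_apply, measureReal_nnreal_smul_apply]
    have := hsub (a i)
    nth_rewrite 1 [← this]
    ring
  have h2 := congrArg (fun ν => ∫ s, V s ∂ν) hm

  rw [integral_add_measure (hint _) (hint _), integral_finsetSum_measure (fun i _ => hint _),
    integral_finsetSum_measure (fun i _ => hint _)] at h2
  rw [← sub_eq_iff_eq_add.2 h2.symm, ← Finset.sum_sub_distrib]
  refine Finset.sum_congr rfl fun i _ => ?_
  rw [integral_add_measure (hint _) (hint _), integral_add_measure (hint _) (hint _)]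
  simp only [integral_smul_nnreal_measure, NNReal.smul_def, smul_eq_mul]
  have := hsub (a i)
  nth_rewrite 5 [← this]
  ring

variable {S A : Type*} [MeasurableSpace S] [MeasurableSpace A] {d : ℕ}

/-- Bellman targets are linear in the features. -/
theorem exists_bellman_eq (M : LinearMDP S A d) (t : ℕ) {V : S → ℝ} (hV : Measurable V) {C : ℝ}
    (hC : ∀ s, |V s| ≤ C) : ∃ w : Fin d → ℝ, ∀ x, bellman M t V x = M.φ x ⬝ᵥ w := by
  refine ⟨fun j => M.υ t j + (∫ s, V s ∂(M.μ t j).toJordanDecomposition.posPart -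
    ∫ s, V s ∂(M.μ t j).toJordanDecomposition.negPart), fun x => ?_⟩
  have := M.markov t
  have := integral_eq_of_real_eq (M.P t x) (fun j => (M.μ t j).toJordanDecomposition.posPart)
    (fun j => (M.μ t j).toJordanDecomposition.negPart) (M.φ x) (fun B hB => by
      rw [M.P_eq t x B hB]
      refine Finset.sum_congr rfl fun j _ => ?_
      conv_lhs => rw [← SignedMeasure.toSignedMeasure_toJordanDecomposition (M.μ t j)]
      rw [JordanDecomposition.toSignedMeasure, Measure.toSignedMeasure_sub_apply hB]) hV hC
  unfold bellman
  rw [this, M.r_eq, dotProduct_comm]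
  simp only [dotProduct, mul_add, Finset.sum_add_distrib]

theorem measurable_bellman (M : LinearMDP S A d) (t : ℕ) {V : S → ℝ} (hV : Measurable V) {C : ℝ}
    (hC : ∀ s, |V s| ≤ C) : Measurable (bellman M t V) := by
  obtain ⟨w, hw⟩ := exists_bellman_eq M t hV hC
  rw [show bellman M t V = fun x => M.φ x ⬝ᵥ w from funext hw]
  unfold dotProduct
  have := measurable_φ_apply M
  fun_prop

theorem measurable_r (M : LinearMDP S A d) (t : ℕ) : Measurable (M.r t) := by
  rw [show M.r t = fun x => M.υ t ⬝ᵥ M.φ x from funext (M.r_eq t)]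
  unfold dotProduct
  have := measurable_φ_apply M
  fun_prop

theorem integral_mem_Icc {X : Type*} [MeasurableSpace X] (ν : Measure X) [IsProbabilityMeasure ν]
    {V : X → ℝ} (hV : Measurable V) {a b : ℝ} (h : ∀ s, V s ∈ Set.Icc a b) :
    ∫ s, V s ∂ν ∈ Set.Icc a b := by
  have hi : Integrable V ν :=
    Integrable.of_mem_Icc a b hV.aemeasurable (Filter.Eventually.of_forall h)
  constructor
  · simpa using integral_mono (integrable_const a) hi fun s => (h s).1
  · simpa using integral_mono hi (integrable_const b) fun s => (h s).2

theorem bellman_mem_Icc (M : LinearMDP S A d) (t : ℕ) {V : S → ℝ} (hV : Measurable V) {b : ℝ}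
    (h : ∀ s, V s ∈ Set.Icc 0 b) (x : S × A) : bellman M t V x ∈ Set.Icc 0 (1 + b) := by
  have := M.markov t
  have h1 := integral_mem_Icc (M.P t x) hV h
  have h2 := M.r_mem t x
  exact ⟨add_nonneg h2.1 h1.1, add_le_add h2.2 h1.2⟩

end Bellman

/-! ### State laws, telescoping and the pessimism argument -/

section Policies

variable {S A : Type*} [MeasurableSpace S] [MeasurableSpace A] {d : ℕ}

instance stateLaw_isProbabilityMeasure (M : LinearMDP S A d) (π : ℕ → Kernel S A)
    [∀ t, IsMarkovKernel (π t)] (ρ : Measure S) [IsProbabilityMeasure ρ] (t : ℕ) :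
    IsProbabilityMeasure (stateLaw M π ρ t) := by
  induction t with
  | zero => assumption
  | succ t ih =>
    have := M.markov t
    unfold stateLaw
    infer_instance

instance policy_isMarkovKernel {M : LinearMDP S A d} {T : ℕ} {D : ℕ → StepData S A} {α : ℕ → ℝ}
    (R : Run M T D α) (t : ℕ) : IsMarkovKernel (R.policy t) := by
  unfold Run.policy
  infer_instance

theorem integrable_of_abs_le {X : Type*} [MeasurableSpace X] (ν : Measure X) [IsFiniteMeasure ν]
    {V : X → ℝ} (hV : Measurable V) {C : ℝ} (h : ∀ s, |V s| ≤ C) : Integrable V ν :=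
  Integrable.of_bound hV.aestronglyMeasurable C (Filter.Eventually.of_forall h)

theorem expect_mono (M : LinearMDP S A d) (π : ℕ → Kernel S A) [∀ t, IsMarkovKernel (π t)]
    (ρ : Measure S) [IsProbabilityMeasure ρ] (t : ℕ) {f g : S × A → ℝ} (hf : Measurable f)
    (hg : Measurable g) {C C' : ℝ} (hfC : ∀ x, |f x| ≤ C) (hgC : ∀ x, |g x| ≤ C')
    (h : ∀ x, f x ≤ g x) : expect M π ρ t f ≤ expect M π ρ t g :=
  integral_mono (integrable_of_abs_le _ hf hfC) (integrable_of_abs_le _ hg hgC) h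

theorem expect_add (M : LinearMDP S A d) (π : ℕ → Kernel S A) [∀ t, IsMarkovKernel (π t)]
    (ρ : Measure S) [IsProbabilityMeasure ρ] (t : ℕ) {f g : S × A → ℝ} (hf : Measurable f)
    (hg : Measurable g) {C C' : ℝ} (hfC : ∀ x, |f x| ≤ C) (hgC : ∀ x, |g x| ≤ C') :
    expect M π ρ t (fun x => f x + g x) = expect M π ρ t f + expect M π ρ t g :=
  integral_add (integrable_of_abs_le _ hf hfC) (integrable_of_abs_le _ hg hgC)

/-- Expectation of a function of the state alone. -/
theorem expect_fst (M : LinearMDP S A d) (π : ℕ → Kernel S A) [∀ t, IsMarkovKernel (π t)]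
    (ρ : Measure S) [IsProbabilityMeasure ρ] (t : ℕ) {f : S → ℝ} (hf : Measurable f) :
    expect M π ρ t (fun x => f x.1) = ∫ s, f s ∂(stateLaw M π ρ t) := by
  unfold expect
  conv_rhs => rw [← Measure.fst_compProd (stateLaw M π ρ t) (π t)]
  rw [Measure.fst, integral_map measurable_fst.aemeasurable hf.aestronglyMeasurable]

/-- One step of the dynamics. -/
theorem integral_stateLaw_succ (M : LinearMDP S A d) (π : ℕ → Kernel S A)
    [∀ t, IsMarkovKernel (π t)] (ρ : Measure S) [IsProbabilityMeasure ρ] (t : ℕ) {f : S → ℝ}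
    (hf : Measurable f) {C : ℝ} (hC : ∀ s, |f s| ≤ C) :
    ∫ s, f s ∂(stateLaw M π ρ (t + 1)) = expect M π ρ t (fun x => ∫ s, f s ∂(M.P t x)) := by
  have := M.markov t
  have hi : Integrable f (stateLaw M π ρ (t + 1)) := integrable_of_abs_le _ hf hC
  have e : stateLaw M π ρ (t + 1) = (stateLaw M π ρ t ⊗ₘ π t).bind (M.P t) := rfl
  unfold expect
  rw [e] at hi ⊢
  rw [Measure.comp_eq_comp_const_apply] at hi ⊢
  rw [Kernel.integral_comp hi, Kernel.const_apply]

theorem expect_bellman (M : LinearMDP S A d) (π : ℕ → Kernel S A)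
    [∀ t, IsMarkovKernel (π t)] (ρ : Measure S) [IsProbabilityMeasure ρ] (t : ℕ) {f : S → ℝ}
    (hf : Measurable f) {C : ℝ} (hC : ∀ s, |f s| ≤ C) :
    expect M π ρ t (bellman M t f) =
      expect M π ρ t (M.r t) + ∫ s, f s ∂(stateLaw M π ρ (t + 1)) := by
  have := M.markov t
  rw [integral_stateLaw_succ M π ρ t hf hC]
  unfold bellman
  refine expect_add M π ρ t (measurable_r M t) ?_ (C := 1) (C' := C) (fun x => ?_) (fun x => ?_)
  · exact (hf.stronglyMeasurable.integral_kernel (κ := M.P t)).measurable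
  · have := M.r_mem t x
    exact abs_le.2 ⟨by linarith [this.1], this.2⟩
  · have := integral_mem_Icc (M.P t x) hf (a := -C) (b := C) fun s => abs_le.1 (hC s)
    exact abs_le.2 this

/-- Value functions with one-sided Bellman inequalities along `π` bound its cumulative reward. -/
theorem totalReward_le (M : LinearMDP S A d) (T : ℕ) (π : ℕ → Kernel S A)
    [∀ t, IsMarkovKernel (π t)] (ρ : Measure S) [IsProbabilityMeasure ρ] (V : ℕ → S → ℝ)
    (hV : ∀ t ≤ T, Measurable (V t)) {C : ℝ} (hC : ∀ t ≤ T, ∀ s, |V t s| ≤ C)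
    (hT : ∀ s, V T s = 0) (g : ℕ → S × A → ℝ) (hg : ∀ t < T, Measurable (g t))
    (hgC : ∀ t < T, ∃ C, ∀ x, |g t x| ≤ C)
    (h : ∀ t < T, ∀ x, bellman M t (V (t + 1)) x ≤ V t x.1 + g t x) :
    totalReward M T π ρ ≤ ∫ s, V 0 s ∂ρ + ∑ t ∈ Finset.range T, expect M π ρ t (g t) := by
  have step : ∀ t < T, expect M π ρ t (M.r t) ≤ ∫ s, V t s ∂(stateLaw M π ρ t)
      - ∫ s, V (t + 1) s ∂(stateLaw M π ρ (t + 1)) + expect M π ρ t (g t) := by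
    intro t ht
    have h1 := expect_bellman M π ρ t (hV (t + 1) ht) (hC (t + 1) ht)
    obtain ⟨C', hC'⟩ := hgC t ht
    have hm1 : Measurable fun x : S × A => V t x.1 := (hV t ht.le).comp measurable_fst
    have h2 := expect_add M π ρ t hm1 (hg t ht) (fun x => hC t ht.le x.1) hC'
    rw [expect_fst M π ρ t (hV t ht.le)] at h2
    obtain ⟨w, hw⟩ := exists_bellman_eq M t (hV (t + 1) ht) (hC (t + 1) ht)
    have h3 := expect_mono M π ρ t (measurable_bellman M t (hV (t + 1) ht) (hC (t + 1) ht))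
      (hm1.add (hg t ht)) (C := 1 + C) (C' := C + C') (fun x => by
        have := M.markov t
        have := integral_mem_Icc (M.P t x) (hV (t + 1) ht) (a := -C) (b := C)
          fun s => abs_le.1 (hC (t + 1) ht s)
        have hr := M.r_mem t x
        unfold bellman
        exact abs_le.2 ⟨by linarith [this.1, hr.1], by linarith [this.2, hr.2]⟩)
      (fun x => (abs_add_le _ _).trans (add_le_add (hC t ht.le x.1) (hC' x)))
      (h t ht)
    have h4 : expect M π ρ t ((fun x : S × A => V t x.1) + g t) =
        expect M π ρ t (fun x => V t x.1 + g t x) := rfl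
    linarith
  -- The differences of integrated values telescope, and the terminal value vanishes.
  have hs := Finset.sum_le_sum fun t ht => step t (Finset.mem_range.1 ht)
  rw [Finset.sum_add_distrib, Finset.sum_range_sub'] at hs
  simp only [hT, integral_zero, sub_zero] at hs
  exact hs

/-- The reverse telescoping. For a deterministic policy the Bellman inequality is needed only at the
chosen action, since the state-action law is carried by the graph of the policy. -/
theorem le_totalReward (M : LinearMDP S A d) (T : ℕ) (π : ℕ → S → A)
    (hπ : ∀ t, Measurable (π t)) (ρ : Measure S) [IsProbabilityMeasure ρ] (V : ℕ → S → ℝ)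
    (hV : ∀ t ≤ T, Measurable (V t)) {C : ℝ} (hC : ∀ t ≤ T, ∀ s, |V t s| ≤ C)
    (hT : ∀ s, V T s = 0)
    (h : ∀ t < T, ∀ s, V t s ≤ bellman M t (V (t + 1)) (s, π t s)) :
    ∫ s, V 0 s ∂ρ ≤ totalReward M T (fun t => Kernel.deterministic (π t) (hπ t)) ρ := by
  set κ : ℕ → Kernel S A := fun t => Kernel.deterministic (π t) (hπ t) with hκ
  have step : ∀ t < T, ∫ s, V t s ∂(stateLaw M κ ρ t)
      - ∫ s, V (t + 1) s ∂(stateLaw M κ ρ (t + 1)) ≤ expect M κ ρ t (M.r t) := by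
    intro t ht
    have hb := measurable_bellman M t (hV (t + 1) ht) (hC (t + 1) ht)
    have hbC : ∀ x, |bellman M t (V (t + 1)) x| ≤ 1 + C := fun x => by
      have := M.markov t
      have := integral_mem_Icc (M.P t x) (hV (t + 1) ht) (a := -C) (b := C)
        fun s => abs_le.1 (hC (t + 1) ht s)
      have hr := M.r_mem t x
      unfold bellman
      exact abs_le.2 ⟨by linarith [this.1, hr.1], by linarith [this.2, hr.2]⟩
    have h1 := expect_bellman M κ ρ t (hV (t + 1) ht) (hC (t + 1) ht)
    have h2 : ∫ s, V t s ∂(stateLaw M κ ρ t) ≤ expect M κ ρ t (bellman M t (V (t + 1))) := by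
      have hπm : Measurable fun s => (s, π t s) := measurable_id.prodMk (hπ t)
      have h3 : expect M κ ρ t (bellman M t (V (t + 1))) =
          ∫ s, bellman M t (V (t + 1)) (s, π t s) ∂(stateLaw M κ ρ t) := by
        unfold expect
        rw [hκ, Measure.compProd_deterministic, integral_map hπm.aemeasurable
          hb.aestronglyMeasurable]
      rw [h3]
      exact integral_mono (integrable_of_abs_le _ (hV t ht.le) (hC t ht.le))
        (integrable_of_abs_le _ (hb.comp hπm) fun s => hbC _) (h t ht)
    linarith
  have hs := Finset.sum_le_sum fun t ht => step t (Finset.mem_range.1 ht)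
  rw [Finset.sum_range_sub'] at hs
  simp only [hT, integral_zero, sub_zero] at hs
  exact hs

theorem Run.value_mem {M : LinearMDP S A d} {T : ℕ} {D : ℕ → StepData S A} {α : ℕ → ℝ}
    (R : Run M T D α) {t : ℕ} (ht : t ≤ T) (s : S) :
    R.V t s ∈ Set.Icc (0 : ℝ) ((T : ℝ) - t) := by
  rcases ht.lt_or_eq with ht | rfl
  · rw [R.value t ht s]
    have : (t : ℝ) ≤ T := by exact_mod_cast ht.le
    exact ⟨le_max_left _ _, max_le (by linarith) (min_le_left _ _)⟩
  · rw [R.terminal]; simp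

theorem measurable_pessQ (M : LinearMDP S A d) (T t : ℕ) (α : ℝ) (D : StepData S A)
    (w : Fin d → ℝ) : Measurable (pessQ M T t α D w) := by
  have h1 : Measurable fun x => M.φ x ⬝ᵥ w := by
    unfold dotProduct
    have := measurable_φ_apply M
    fun_prop
  exact measurable_const.max (measurable_const.min
    (h1.sub ((measurable_uncertainty M D).const_mul α)))

theorem Run.measurable_V {M : LinearMDP S A d} {T : ℕ} {D : ℕ → StepData S A} {α : ℕ → ℝ}
    (R : Run M T D α) {t : ℕ} (ht : t ≤ T) : Measurable (R.V t) := by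
  rcases ht.lt_or_eq with ht | rfl
  · rw [show R.V t = _ from funext (R.value t ht)]
    exact (measurable_pessQ M T t _ _ _).comp (measurable_id.prodMk (R.measurable_π t))
  · rw [show R.V t = fun _ => 0 from funext R.terminal]
    exact measurable_const

theorem measurable_lcb (M : LinearMDP S A d) (β : ℝ) (D : StepData S A) :
    Measurable (lcb M β D) := (measurable_uncertainty M D).const_mul β

theorem lcb_bounded (M : LinearMDP S A d) (β : ℝ) (D : StepData S A) :
    ∃ C, ∀ x, |lcb M β D x| ≤ C := by
  obtain ⟨C, hC⟩ := uncertainty_bounded M D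
  refine ⟨|β| * C, fun x => ?_⟩
  rw [lcb, abs_mul, abs_of_nonneg (uncertainty_nonneg M D x)]
  exact mul_le_mul_of_nonneg_left (hC x) (abs_nonneg _)

/-- Pessimism: with valid confidence widths `b`, the sub-optimality is at most the expected
lower-confidence-bound terms. -/
theorem subOpt_le {M : LinearMDP S A d} {T : ℕ} {D : ℕ → StepData S A} {α : ℕ → ℝ}
    (R : Run M T D α) (π : ℕ → Kernel S A) [∀ t, IsMarkovKernel (π t)] (ρ : Measure S)
    [IsProbabilityMeasure ρ] (b β : ℕ → ℝ) (hα : ∀ t < T, b t ≤ α t)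
    (hβ : ∀ t < T, α t + b t ≤ β t)
    (hb : ∀ t < T, ∀ x, |M.φ x ⬝ᵥ R.w t - bellman M t (R.V (t + 1)) x| ≤
      b t * uncertainty M (D t) x) :
    subOpt M T π R.policy ρ ≤
      ∑ t ∈ Finset.range T, expect M π ρ t (lcb M (β t) (D t)) := by
  have hVm : ∀ t ≤ T, Measurable (R.V t) := fun t ht => R.measurable_V ht
  have hVC : ∀ t ≤ T, ∀ s, |R.V t s| ≤ (T : ℝ) := fun t ht s => by
    have := R.value_mem ht s
    have ht0 : (0 : ℝ) ≤ t := Nat.cast_nonneg t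
    exact abs_le.2 ⟨by linarith [this.1, (Nat.cast_nonneg T : (0 : ℝ) ≤ T)], by linarith [this.2]⟩
  have hB : ∀ t < T, ∀ x, bellman M t (R.V (t + 1)) x ∈ Set.Icc (0 : ℝ) ((T : ℝ) - t) :=
    fun t ht x => by
      have := bellman_mem_Icc M t (hVm (t + 1) ht) (fun s => R.value_mem ht s) x
      push_cast at this
      exact ⟨this.1, by linarith [this.2]⟩
  have hle : ∀ t < T, ∀ x, pessQ M T t (α t) (D t) (R.w t) x ≤ bellman M t (R.V (t + 1)) x := by
    intro t ht x
    refine max_le (hB t ht x).1 ((min_le_right _ _).trans ?_)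
    have h1 := (abs_le.1 (hb t ht x)).2
    have h2 := mul_le_mul_of_nonneg_right (hα t ht) (uncertainty_nonneg M (D t) x)
    linarith
  have hge : ∀ t < T, ∀ x, bellman M t (R.V (t + 1)) x ≤
      pessQ M T t (α t) (D t) (R.w t) x + lcb M (β t) (D t) x := by
    intro t ht x
    have h1 := (abs_le.1 (hb t ht x)).1
    have h2 := mul_le_mul_of_nonneg_right (hβ t ht) (uncertainty_nonneg M (D t) x)
    have hU := uncertainty_nonneg M (D t) x
    have h0 : 0 ≤ b t * uncertainty M (D t) x := (abs_nonneg _).trans (hb t ht x)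
    have h3 := mul_le_mul_of_nonneg_right (hα t ht) (uncertainty_nonneg M (D t) x)
    -- The cap `T - t` is harmless: the Bellman target respects it, and `β U ≥ α U + b U ≥ 2 b U ≥
    -- 0`. Under the other branch of the minimum, `β - α` pays for the regression error.
    have h4 : bellman M t (R.V (t + 1)) x - lcb M (β t) (D t) x ≤
        min ((T : ℝ) - t) (M.φ x ⬝ᵥ R.w t - α t * uncertainty M (D t) x) := by
      unfold lcb
      refine le_min ?_ ?_
      · linarith [(hB t ht x).2]
      · linarith
    have h5 := h4.trans (le_max_right 0 _)
    unfold pessQ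
    linarith
  have hup := totalReward_le M T π ρ R.V hVm hVC R.terminal (fun t => lcb M (β t) (D t))
    (fun t _ => measurable_lcb M _ _) (fun t _ => lcb_bounded M _ _) (fun t ht x => by
      refine (hge t ht x).trans (add_le_add_left ?_ _)
      rw [R.value t ht x.1]
      exact R.greedy t ht x.1 x.2)
  have hlo := le_totalReward M T R.π R.measurable_π ρ R.V hVm hVC R.terminal (fun t ht s => by
      rw [R.value t ht s]
      exact hle t ht _)
  unfold subOpt
  have : totalReward M T R.policy ρ =
    totalReward M T (fun t => Kernel.deterministic (R.π t) (R.measurable_π t)) ρ := rfl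
  linarith

theorem sum_expect_lcb_union_le (M : LinearMDP S A d) (T : ℕ) (π : ℕ → Kernel S A)
    [∀ t, IsMarkovKernel (π t)] (ρ : Measure S) [IsProbabilityMeasure ρ] {β : ℕ → ℝ}
    (hβ : ∀ t < T, 0 ≤ β t) (D D' : ℕ → StepData S A) (h : ∀ t < T, (cov M (D t)).PosDef) :
    ∑ t ∈ Finset.range T, expect M π ρ t (lcb M (β t) ((D t).union (D' t))) ≤
      ∑ t ∈ Finset.range T, expect M π ρ t (lcb M (β t) (D t)) := by
  refine Finset.sum_le_sum fun t ht => ?_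
  have ht := Finset.mem_range.1 ht
  obtain ⟨C, hC⟩ := lcb_bounded M (β t) (D t)
  obtain ⟨C', hC'⟩ := lcb_bounded M (β t) ((D t).union (D' t))
  exact expect_mono M π ρ t (measurable_lcb M _ _) (measurable_lcb M _ _) hC' hC fun x =>
    mul_le_mul_of_nonneg_left (uncertainty_union_le M (h t ht) _ x) (hβ t ht)

end Policies

/-! ### Exponential supermartingale for the transition noise -/

section Concentration

/-- Integrating out the next state, when its conditional law given `f` is the kernel `κ`. -/
theorem lintegral_next_le {Ω X S : Type*} [MeasurableSpace Ω] [MeasurableSpace X]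
    [MeasurableSpace S] (Pr : Measure Ω) [IsProbabilityMeasure Pr] {f : Ω → X} (hf : Measurable f)
    (κ : Kernel X S) [IsMarkovKernel κ] {s' : Ω → S} (hs' : Measurable s')
    (hcond : ∀ B : Set S, MeasurableSet B →
      Pr[(s' ⁻¹' B).indicator (fun _ => (1 : ℝ)) | MeasurableSpace.comap f inferInstance]
        =ᵐ[Pr] fun ω => (κ (f ω)).real B)
    {F : X × S → ENNReal} (hF : Measurable F) {W : X → ENNReal}
    (hW : Measurable W) (h : ∀ x, ∫⁻ s, F (x, s) ∂(κ x) ≤ W x) :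
    ∫⁻ ω, F (f ω, s' ω) ∂Pr ≤ ∫⁻ ω, W (f ω) ∂Pr := by
  have hg : Measurable fun ω => (f ω, s' ω) := hf.prodMk hs'
  have : IsProbabilityMeasure (Pr.map f) := Measure.isProbabilityMeasure_map hf.aemeasurable
  -- The joint law of history and next state is checked on rectangles, where it is the defining
  -- property of conditional expectation.
  have heq : Pr.map (fun ω => (f ω, s' ω)) = Pr.map f ⊗ₘ κ := by
    refine Measure.ext_prod (fun {H B} hH hB => ?_)
    rw [Measure.map_apply hg (hH.prod hB), Measure.compProd_apply_prod hH hB,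
      setLIntegral_map hH (κ.measurable_coe hB) hf]
    have hset : MeasurableSet (s' ⁻¹' B) := hs' hB
    have hi : Integrable ((s' ⁻¹' B).indicator (fun _ => (1 : ℝ))) Pr :=
      (integrable_const 1).indicator hset
    have h1 := setIntegral_condExp hf.comap_le hi ⟨H, hH, rfl⟩
    rw [setIntegral_congr_ae (hf hH) ((hcond B hB).mono fun ω hω _ => hω),
      setIntegral_indicator hset, setIntegral_const, smul_eq_mul, mul_one] at h1
    have h2 : ∀ x, κ x B = ENNReal.ofReal ((κ x).real B) := fun ω =>
      (ofReal_measureReal (measure_ne_top _ _)).symm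
    have h3 : Measurable fun ω => (κ (f ω)).real B :=
      ((κ.measurable_coe hB).comp hf).ennreal_toReal
    simp only [h2]
    rw [← ofReal_integral_eq_lintegral_ofReal, h1, ofReal_measureReal (measure_ne_top _ _)]
    · rfl
    · refine Integrable.of_bound h3.aestronglyMeasurable 1 (Filter.Eventually.of_forall fun ω => ?_)
      rw [Real.norm_eq_abs, abs_of_nonneg measureReal_nonneg]
      exact measureReal_le_one
    · exact Filter.Eventually.of_forall fun ω => measureReal_nonneg
  rw [← lintegral_map (μ := Pr) hF hg, heq, Measure.lintegral_compProd hF, ← lintegral_map hW hf]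
  exact lintegral_mono h

/-- Hoeffding's lemma for a centred bounded function. -/
theorem lintegral_exp_le {S : Type*} [MeasurableSpace S] (P : Measure S) [IsProbabilityMeasure P]
    {V : S → ℝ} (hV : Measurable V) {b : ℝ} (hb : ∀ s, V s ∈ Set.Icc 0 b) (θ : ℝ) :
    ∫⁻ s, ENNReal.ofReal (Real.exp (θ * (V s - ∫ s, V s ∂P) - θ ^ 2 * b ^ 2 / 2)) ∂P ≤ 1 := by
  have hsub := hasSubgaussianMGF_of_mem_Icc (μ := P) hV.aemeasurable
    (Filter.Eventually.of_forall hb)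
  have hmgf := hsub.mgf_le θ
  have hint := hsub.integrable_exp_mul θ
  -- Hoeffding's variance proxy is `(b / 2)²`; the weaker `b²` is enough.
  have hbnd : Real.exp ((((‖b - 0‖₊ / 2) ^ 2 : NNReal) : ℝ) * θ ^ 2 / 2) ≤
      Real.exp (θ ^ 2 * b ^ 2 / 2) := by
    apply Real.exp_le_exp.2
    push_cast
    rw [sub_zero, Real.norm_eq_abs, div_pow, sq_abs]
    nlinarith [mul_nonneg (sq_nonneg b) (sq_nonneg θ)]
  have h2 : ∫ s, Real.exp (θ * (V s - ∫ s, V s ∂P) - θ ^ 2 * b ^ 2 / 2) ∂P ≤ 1 := by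
    simp only [Real.exp_sub _ (θ ^ 2 * b ^ 2 / 2)]
    rw [integral_div, div_le_one (Real.exp_pos _)]
    exact hmgf.trans hbnd
  rw [← ofReal_integral_eq_lintegral_ofReal]
  · exact ENNReal.ofReal_le_one.2 h2
  · simp only [Real.exp_sub _ (θ ^ 2 * b ^ 2 / 2)]
    exact hint.div_const _
  · exact Filter.Eventually.of_forall fun s => (Real.exp_pos _).le

variable {S A Ω : Type*} [MeasurableSpace S] [MeasurableSpace A] [MeasurableSpace Ω] {d : ℕ}

/-- Exponent of the supermartingale: one transition. -/
def expTerm (M : LinearMDP S A d) (t : ℕ) (V : S → ℝ) (b : ℝ) (ψ : S × A → ℝ)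
    (z : S × A × S) : ℝ :=
  ψ (z.1, z.2.1) * (V z.2.2 - ∫ s, V s ∂(M.P t (z.1, z.2.1))) - ψ (z.1, z.2.1) ^ 2 * b ^ 2 / 2

theorem measurable_expTerm (M : LinearMDP S A d) (t : ℕ) {V : S → ℝ} (hV : Measurable V) (b : ℝ)
    {ψ : S × A → ℝ} (hψ : Measurable ψ) : Measurable (expTerm M t V b ψ) := by
  have hx : Measurable fun z : S × A × S => (z.1, z.2.1) :=
    measurable_fst.prodMk (measurable_fst.comp measurable_snd)
  have h1 : Measurable fun x => ∫ s, V s ∂(M.P t x) :=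
    have := M.markov t
    (hV.stronglyMeasurable.integral_kernel (κ := M.P t)).measurable
  have h2 : Measurable fun z : S × A × S => V z.2.2 :=
    hV.comp (measurable_snd.comp measurable_snd)
  have h3 := hψ.comp hx
  have h4 := h1.comp hx
  unfold expTerm
  exact (h3.mul (h2.sub h4)).sub (((h3.pow_const 2).mul_const _).div_const _)

/-- The history of transition `k`, as a random variable. -/
def histMap (Z : ℕ → Ω → S × A × S) (k : ℕ) (ω : Ω) : (Fin k → S × A × S) × (S × A) :=
  (fun j => Z j ω, (Z k ω).1, (Z k ω).2.1)

omit [MeasurableSpace Ω] in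
-- Presents the history as generated by one random variable, the form in which `lintegral_next_le`
-- conditions on it.
theorem comap_histMap (Z : ℕ → Ω → S × A × S) (k : ℕ) :
    MeasurableSpace.comap (histMap Z k) inferInstance = hist Z k := by
  have h : MeasurableSpace.comap (histMap Z k) inferInstance =
      MeasurableSpace.comap (fun ω (j : Fin k) => Z j ω) inferInstance ⊔
        MeasurableSpace.comap (fun ω => ((Z k ω).1, (Z k ω).2.1)) inferInstance :=
    MeasurableSpace.comap_prodMk _ _
  rw [h]
  unfold hist
  congr 1
  change MeasurableSpace.comap _ MeasurableSpace.pi = _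
  unfold MeasurableSpace.pi
  rw [MeasurableSpace.comap_iSup]
  simp only [MeasurableSpace.comap_comp]
  apply le_antisymm
  · exact iSup_le fun j => le_iSup₂_of_le (j : ℕ) j.2 le_rfl
  · exact iSup_le fun j => iSup_le fun hj => le_iSup_of_le (⟨j, hj⟩ : Fin k) le_rfl

theorem measurable_histMap {Z : ℕ → Ω → S × A × S} {k : ℕ} (hZ : ∀ i ≤ k, Measurable (Z i)) :
    Measurable (histMap Z k) := by
  refine Measurable.prodMk (measurable_pi_lambda _ fun j => hZ j j.2.le) ?_
  exact (measurable_fst.comp (hZ k le_rfl)).prodMk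
    (measurable_fst.comp (measurable_snd.comp (hZ k le_rfl)))

/-- The weight `ψ` of a transition depends only on its state and action, hence is fixed given the
history. By `lintegral_exp_le` the last factor then has conditional mean at most one, and it is
removed by induction. -/
theorem lintegral_exp_sum_le {Pr : Measure Ω} [IsProbabilityMeasure Pr] {M : LinearMDP S A d}
    {T n : ℕ} {Z : ℕ → ℕ → Ω → S × A × S} (hZ : Collected M Pr T n Z) {t : ℕ} (ht : t < T)
    {V : S → ℝ} (hV : Measurable V) {b : ℝ} (hb : ∀ s, V s ∈ Set.Icc 0 b) {ψ : S × A → ℝ}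
    (hψ : Measurable ψ) {k : ℕ} (hk : k ≤ n) :
    ∫⁻ ω, ENNReal.ofReal (Real.exp (∑ i ∈ Finset.range k, expTerm M t V b ψ (Z t i ω))) ∂Pr ≤ 1 := by
  induction k with
  | zero => simp
  | succ k ih =>
    have hkn : k < n := hk
    refine le_trans ?_ (ih hkn.le)
    have := M.markov t
    have he := measurable_expTerm M t hV b hψ
    set κ : Kernel ((Fin k → S × A × S) × (S × A)) S :=
      (M.P t).comap Prod.snd measurable_snd with hκ
    set w : (Fin k → S × A × S) × (S × A) → ℝ := fun x => ∑ i, expTerm M t V b ψ (x.1 i) with hw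
    have hwm : Measurable w := Finset.measurable_fun_sum _ fun i _ =>
      he.comp ((measurable_pi_apply i).comp measurable_fst)
    have key := lintegral_next_le Pr (f := histMap (Z t) k) (κ := κ)
      (measurable_histMap fun i hi => hZ.measurable t ht i (hi.trans_lt hkn))
      (s' := fun ω => (Z t k ω).2.2)
      (measurable_snd.comp (measurable_snd.comp (hZ.measurable t ht k hkn)))
      (by rw [comap_histMap]; exact hZ.next t ht k hkn)
      (F := fun p => ENNReal.ofReal (Real.exp
        (w p.1 + expTerm M t V b ψ (p.1.2.1, p.1.2.2, p.2))))
      (by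
        refine ENNReal.measurable_ofReal.comp (Real.measurable_exp.comp (Measurable.add ?_ ?_))
        · exact hwm.comp measurable_fst
        · exact he.comp (by fun_prop))
      (W := fun x => ENNReal.ofReal (Real.exp (w x)))
      (ENNReal.measurable_ofReal.comp (Real.measurable_exp.comp hwm))
      (fun x => by
        simp only [Real.exp_add, ENNReal.ofReal_mul (Real.exp_pos _).le]
        rw [lintegral_const_mul' _ _ ENNReal.ofReal_ne_top]
        exact mul_le_of_le_one_right' (lintegral_exp_le (M.P t x.2) hV hb (ψ x.2)))
    simp only [Finset.sum_range_succ]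
    simpa only [hw, histMap, Prod.mk.eta, Finset.sum_range] using key

/-- Tail bound for a fixed value function and a fixed direction. -/
theorem measure_expTerm_sum_ge_le {Pr : Measure Ω} [IsProbabilityMeasure Pr]
    {M : LinearMDP S A d} {T n : ℕ} {Z : ℕ → ℕ → Ω → S × A × S} (hZ : Collected M Pr T n Z)
    {t : ℕ} (ht : t < T) {V : S → ℝ} (hV : Measurable V) {b : ℝ} (hb : ∀ s, V s ∈ Set.Icc 0 b)
    {ψ : S × A → ℝ} (hψ : Measurable ψ) (L : ℝ) :
    Pr {ω | L ≤ ∑ i ∈ Finset.range n, expTerm M t V b ψ (Z t i ω)} ≤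
      ENNReal.ofReal (Real.exp (-L)) := by
  have hm : Measurable fun ω => ENNReal.ofReal
      (Real.exp (∑ i ∈ Finset.range n, expTerm M t V b ψ (Z t i ω))) :=
    ENNReal.measurable_ofReal.comp (Real.measurable_exp.comp (Finset.measurable_fun_sum _
      fun i hi => (measurable_expTerm M t hV b hψ).comp
        (hZ.measurable t ht i (Finset.mem_range.1 hi))))
  have h1 := mul_meas_ge_le_lintegral hm (μ := Pr) (ENNReal.ofReal (Real.exp L))
  have h2 := h1.trans (lintegral_exp_sum_le hZ ht hV hb hψ le_rfl)
  simp only [ENNReal.ofReal_le_ofReal_iff (Real.exp_pos _).le, Real.exp_le_exp] at h2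
  rw [Real.exp_neg, ENNReal.ofReal_inv_of_pos (Real.exp_pos _), ← one_div,
    ENNReal.le_div_iff_mul_le (Or.inl (by simp [Real.exp_pos])) (Or.inl ENNReal.ofReal_ne_top),
    mul_comm]
  exact h2

end Concentration

/-! ### A grid of value functions and directions -/

section Net

variable {S A : Type*} [MeasurableSpace S] [MeasurableSpace A] {d : ℕ}

/-- Truncated pessimistic action values, parametrized by `w` and the penalty form `B`. -/
def truncQ (M : LinearMDP S A d) (h : ℝ) (w : Fin d → ℝ) (B : Matrix (Fin d) (Fin d) ℝ)
    (x : S × A) : ℝ :=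
  max 0 (min h (M.φ x ⬝ᵥ w - Real.sqrt (M.φ x ⬝ᵥ (B *ᵥ M.φ x))))

/-- `V` is a measurable function that is the attained maximum over actions of `truncQ M h w B`. -/
structure IsValue (M : LinearMDP S A d) (h : ℝ) (w : Fin d → ℝ) (B : Matrix (Fin d) (Fin d) ℝ)
    (V : S → ℝ) : Prop where
  measurable : Measurable V
  ge : ∀ s a, truncQ M h w B (s, a) ≤ V s
  attained : ∀ s, ∃ a, V s = truncQ M h w B (s, a)

theorem IsValue.mem_Icc {M : LinearMDP S A d} {h : ℝ} (hh : 0 ≤ h) {w : Fin d → ℝ}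
    {B : Matrix (Fin d) (Fin d) ℝ} {V : S → ℝ} (hV : IsValue M h w B V) (s : S) :
    V s ∈ Set.Icc 0 h := by
  obtain ⟨a, ha⟩ := hV.attained s
  rw [ha]
  exact ⟨le_max_left _ _, max_le hh (min_le_left _ _)⟩

/-- Negative arguments are allowed, as the matrices in a cell need not be positive semidefinite. The
Hölder exponent `1/2` is the reason that a mesh `K ^ (-8)` yields only accuracy of order `d K ^
(-4)`. -/
theorem abs_sqrt_sub_sqrt_le (a b : ℝ) : |Real.sqrt a - Real.sqrt b| ≤ Real.sqrt |a - b| := by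
  have key : ∀ a b : ℝ, Real.sqrt a ≤ Real.sqrt b + Real.sqrt |a - b| := fun a b => by
    rcases le_or_gt b 0 with hb | hb
    · rw [Real.sqrt_eq_zero_of_nonpos hb, zero_add]
      exact Real.sqrt_le_sqrt (by linarith [le_abs_self (a - b)])
    · apply Real.sqrt_le_iff.2
      refine ⟨by positivity, ?_⟩
      have h1 := Real.sq_sqrt hb.le
      have h2 := Real.sq_sqrt (abs_nonneg (a - b))
      have h3 := mul_nonneg (Real.sqrt_nonneg b) (Real.sqrt_nonneg |a - b|)
      nlinarith [le_abs_self (a - b)]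
  have h1 := key a b
  have h2 := key b a
  rw [abs_sub_comm] at h2
  exact abs_le.2 ⟨by linarith, by linarith⟩

theorem abs_truncQ_sub_le (M : LinearMDP S A d) (h : ℝ) {w w' : Fin d → ℝ}
    {B B' : Matrix (Fin d) (Fin d) ℝ} (x : S × A) {e₁ e₂ : ℝ}
    (h₁ : |M.φ x ⬝ᵥ w - M.φ x ⬝ᵥ w'| ≤ e₁)
    (h₂ : |M.φ x ⬝ᵥ (B *ᵥ M.φ x) - M.φ x ⬝ᵥ (B' *ᵥ M.φ x)| ≤ e₂) :
    |truncQ M h w B x - truncQ M h w' B' x| ≤ e₁ + Real.sqrt e₂ := by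
  unfold truncQ
  have h3 := (abs_sqrt_sub_sqrt_le _ _).trans (Real.sqrt_le_sqrt h₂)
  rw [max_comm 0, max_comm 0]
  refine (abs_max_sub_max_le_abs _ _ _).trans ((abs_min_sub_min_le_max _ _ _ _).trans ?_)
  rw [sub_self, abs_zero, max_eq_right (abs_nonneg _)]
  rw [abs_le] at *
  constructor <;> linarith [h₁.1, h₁.2, h3.1, h3.2]

/-- Each value is compared with the other one at its own maximizing action. -/
theorem IsValue.abs_sub_le {M : LinearMDP S A d} {h : ℝ} {w w' : Fin d → ℝ}
    {B B' : Matrix (Fin d) (Fin d) ℝ} {V V' : S → ℝ} (hV : IsValue M h w B V)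
    (hV' : IsValue M h w' B' V') {e : ℝ}
    (he : ∀ x, |truncQ M h w B x - truncQ M h w' B' x| ≤ e) (s : S) : |V s - V' s| ≤ e := by
  obtain ⟨a, ha⟩ := hV.attained s
  obtain ⟨a', ha'⟩ := hV'.attained s
  have h1 := (abs_le.1 (he (s, a))).2
  have h2 := (abs_le.1 (he (s, a'))).1
  have h3 := hV.ge s a'
  have h4 := hV'.ge s a
  exact abs_le.2 ⟨by linarith, by linarith⟩

theorem abs_φ_dotProduct_le (M : LinearMDP S A d) (x : S × A) {v : Fin d → ℝ} {e : ℝ}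
    (hv : ∀ j, |v j| ≤ e) : |M.φ x ⬝ᵥ v| ≤ d * e := by
  unfold dotProduct
  refine (Finset.abs_sum_le_sum_abs _ _).trans ?_
  have : ∑ _j : Fin d, e = d * e := by simp
  rw [← this]
  refine Finset.sum_le_sum fun j _ => ?_
  rw [abs_mul]
  calc |M.φ x j| * |v j| ≤ 1 * e :=
        mul_le_mul (φ_apply_le M x j) (hv j) (abs_nonneg _) zero_le_one
    _ = e := one_mul e

theorem abs_φ_form_le (M : LinearMDP S A d) (x : S × A) {B : Matrix (Fin d) (Fin d) ℝ} {e : ℝ}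
    (hB : ∀ i j, |B i j| ≤ e) : |M.φ x ⬝ᵥ (B *ᵥ M.φ x)| ≤ d * (d * e) :=
  abs_φ_dotProduct_le M x fun i => by
    unfold Matrix.mulVec
    rw [dotProduct_comm]
    exact abs_φ_dotProduct_le M x (hB i)

/-- Indices of the parameters: `w`, `B` and a direction. -/
abbrev ParamIdx (d : ℕ) := Fin d ⊕ (Fin d × Fin d) ⊕ Fin d

/-- The parameters `w`, `B` lie in the cell `c` of the grid of mesh `1 / R`. -/
def InCell (R : ℝ) (c : ParamIdx d → ℤ) (w : Fin d → ℝ) (B : Matrix (Fin d) (Fin d) ℝ) : Prop :=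
  (∀ j, ⌊w j * R⌋ = c (.inl j)) ∧ ∀ i j, ⌊B i j * R⌋ = c (.inr (.inl (i, j)))

open Classical in
/-- A representative of the value functions with parameters in the cell `c`. -/
def netValue (M : LinearMDP S A d) (h R : ℝ) (c : ParamIdx d → ℤ) : S → ℝ :=
  if hx : ∃ V : S → ℝ, ∃ w B, IsValue M h w B V ∧ InCell R c w B then hx.choose else 0

/-- The direction of the cell `c`. -/
def netDir (R : ℝ) (c : ParamIdx d → ℤ) : Fin d → ℝ := fun j => c (.inr (.inr j)) / R

/-- The representative is an actual member of the class, or zero, and so inherits measurability. A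
maximum over actions taken at a grid point might be neither attained nor measurable. -/
theorem measurable_netValue (M : LinearMDP S A d) (h R : ℝ) (c : ParamIdx d → ℤ) :
    Measurable (netValue M h R c) := by
  unfold netValue
  split_ifs with hx
  · obtain ⟨w, B, hV, -⟩ := hx.choose_spec
    exact hV.measurable
  · exact measurable_const

theorem netValue_mem_Icc (M : LinearMDP S A d) {h : ℝ} (hh : 0 ≤ h) (R : ℝ) (c : ParamIdx d → ℤ)
    (s : S) : netValue M h R c s ∈ Set.Icc 0 h := by
  unfold netValue
  split_ifs with hx
  · obtain ⟨w, B, hV, -⟩ := hx.choose_spec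
    exact hV.mem_Icc hh s
  · exact ⟨le_rfl, hh⟩

theorem abs_mul_of_nonneg {R : ℝ} (hR : 0 ≤ R) {a : ℝ} : |a * R| = |a| * R := by
  rw [abs_mul, abs_of_nonneg hR]

theorem abs_sub_le_of_floor_eq {R : ℝ} (hR : 0 < R) {a b : ℝ} {z : ℤ} (ha : ⌊a * R⌋ = z)
    (hb : ⌊b * R⌋ = z) : |a - b| ≤ 1 / R := by
  rw [le_div_iff₀ hR, ← abs_mul_of_nonneg hR.le, sub_mul]
  have h1 := Int.floor_le (a * R)
  have h2 := Int.lt_floor_add_one (a * R)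
  have h3 := Int.floor_le (b * R)
  have h4 := Int.lt_floor_add_one (b * R)
  rw [ha] at h1 h2
  rw [hb] at h3 h4
  exact abs_le.2 ⟨by linarith, by linarith⟩

theorem abs_sub_netValue_le {M : LinearMDP S A d} {h R : ℝ} (hR : 0 < R) {c : ParamIdx d → ℤ}
    {w : Fin d → ℝ} {B : Matrix (Fin d) (Fin d) ℝ} {V : S → ℝ} (hV : IsValue M h w B V)
    (hc : InCell R c w B) (s : S) :
    |V s - netValue M h R c s| ≤ d / R + d * Real.sqrt (1 / R) := by
  have hx : ∃ V : S → ℝ, ∃ w B, IsValue M h w B V ∧ InCell R c w B := ⟨V, w, B, hV, hc⟩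
  unfold netValue
  rw [dif_pos hx]
  obtain ⟨w', B', hV', hc'⟩ := hx.choose_spec
  refine hV.abs_sub_le hV' (fun x => ?_) s
  have h1 : |M.φ x ⬝ᵥ w - M.φ x ⬝ᵥ w'| ≤ d * (1 / R) := by
    rw [← dotProduct_sub]
    exact abs_φ_dotProduct_le M x fun j => abs_sub_le_of_floor_eq hR (hc.1 j) (hc'.1 j)
  have h2 : |M.φ x ⬝ᵥ (B *ᵥ M.φ x) - M.φ x ⬝ᵥ (B' *ᵥ M.φ x)| ≤ d * (d * (1 / R)) := by
    rw [← dotProduct_sub, ← Matrix.sub_mulVec]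
    exact abs_φ_form_le M x fun i j => abs_sub_le_of_floor_eq hR (hc.2 i j) (hc'.2 i j)
  refine (abs_truncQ_sub_le M h x h1 h2).trans_eq ?_
  rw [← mul_assoc, Real.sqrt_mul (by positivity), Real.sqrt_mul_self (by positivity)]
  ring

/-- The cells of parameters of size at most `K ^ 4`, for mesh `K ^ (-8)`. -/
def cells (d K : ℕ) : Finset (ParamIdx d → ℤ) :=
  Fintype.piFinset fun _ => Finset.Icc (-(K : ℤ) ^ 12) ((K : ℤ) ^ 12)

theorem card_cells_le (d : ℕ) {K : ℕ} (hK : 2 ≤ K) :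
    (cells d K).card ≤ K ^ (14 * (d ^ 2 + 2 * d)) := by
  unfold cells
  rw [Fintype.card_piFinset, Finset.prod_const, Int.card_Icc, Finset.card_univ, pow_mul]
  have h1 : Fintype.card (ParamIdx d) = d ^ 2 + 2 * d := by simp; ring
  rw [h1]
  refine Nat.pow_le_pow_left ?_ _
  have h2 : ((K : ℤ) ^ 12 + 1 - -(K : ℤ) ^ 12).toNat = 2 * K ^ 12 + 1 := by
    have : ((K : ℤ) ^ 12 + 1 - -(K : ℤ) ^ 12) = ((2 * K ^ 12 + 1 : ℕ) : ℤ) := by push_cast; ring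
    rw [this, Int.toNat_natCast]
  -- Since `K ≥ 2`, `2 K ^ 12 + 1 ≤ 4 K ^ 12 ≤ K ^ 14`.
  rw [h2, show 14 = 12 + 2 by rfl, pow_add]
  have h3 : 1 ≤ K ^ 12 := Nat.one_le_pow _ _ (by omega)
  have h4 : 2 ^ 2 ≤ K ^ 2 := Nat.pow_le_pow_left hK 2
  nlinarith

theorem floor_mem_Icc {K : ℕ} {a : ℝ} (h : |a| ≤ (K : ℝ) ^ 4) :
    ⌊a * (K : ℝ) ^ 8⌋ ∈ Finset.Icc (-(K : ℤ) ^ 12) ((K : ℤ) ^ 12) := by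
  have h1 : |a * (K : ℝ) ^ 8| ≤ (K : ℝ) ^ 12 := by
    rw [abs_mul, abs_of_nonneg (by positivity : (0 : ℝ) ≤ (K : ℝ) ^ 8)]
    calc |a| * (K : ℝ) ^ 8 ≤ (K : ℝ) ^ 4 * (K : ℝ) ^ 8 := by gcongr
      _ = (K : ℝ) ^ 12 := by ring
  rw [abs_le] at h1
  rw [Finset.mem_Icc]
  constructor
  · rw [Int.le_floor]; push_cast; linarith [h1.1]
  · have := (Int.floor_le (a * (K : ℝ) ^ 8)).trans h1.2
    exact_mod_cast this

/-- The cell of a parameter. -/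
def cellOf (K : ℕ) (w : Fin d → ℝ) (B : Matrix (Fin d) (Fin d) ℝ) (u : Fin d → ℝ) :
    ParamIdx d → ℤ
  | .inl j => ⌊w j * (K : ℝ) ^ 8⌋
  | .inr (.inl p) => ⌊B p.1 p.2 * (K : ℝ) ^ 8⌋
  | .inr (.inr j) => ⌊u j * (K : ℝ) ^ 8⌋

theorem cellOf_mem {K : ℕ} {w : Fin d → ℝ} {B : Matrix (Fin d) (Fin d) ℝ} {u : Fin d → ℝ}
    (hw : ∀ j, |w j| ≤ (K : ℝ) ^ 4) (hB : ∀ i j, |B i j| ≤ (K : ℝ) ^ 4)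
    (hu : ∀ j, |u j| ≤ (K : ℝ) ^ 4) : cellOf K w B u ∈ cells d K := by
  refine Fintype.mem_piFinset.2 fun i => ?_
  rcases i with j | p | j
  · exact floor_mem_Icc (hw j)
  · exact floor_mem_Icc (hB _ _)
  · exact floor_mem_Icc (hu j)

theorem inCell_cellOf (K : ℕ) (w : Fin d → ℝ) (B : Matrix (Fin d) (Fin d) ℝ) (u : Fin d → ℝ) :
    InCell ((K : ℝ) ^ 8) (cellOf K w B u) w B := ⟨fun _ => rfl, fun _ _ => rfl⟩

theorem abs_sub_netDir_le {K : ℕ} (hK : 0 < K) (w : Fin d → ℝ) (B : Matrix (Fin d) (Fin d) ℝ)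
    (u : Fin d → ℝ) (j : Fin d) :
    |u j - netDir ((K : ℝ) ^ 8) (cellOf K w B u) j| ≤ 1 / (K : ℝ) ^ 8 := by
  have hR : (0 : ℝ) < (K : ℝ) ^ 8 := by positivity
  unfold netDir cellOf
  have h1 := Int.floor_le (u j * (K : ℝ) ^ 8)
  have h2 := Int.lt_floor_add_one (u j * (K : ℝ) ^ 8)
  rw [le_div_iff₀ hR, ← abs_mul_of_nonneg hR.le, sub_mul, div_mul_cancel₀ _ hR.ne']
  exact abs_le.2 ⟨by linarith, by linarith⟩

/-- Logarithm of the inverse failure probability of a single cell. -/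
def logLevel (d K : ℕ) : ℝ := ((14 * (d ^ 2 + 2 * d) + 2 : ℕ) : ℝ) * Real.log K

/-- The main part of the exponent in `logLevel` pays for the number of cells, and the extra `2`
leaves `K⁻²`: one factor `K⁻¹` absorbs `2T/ξ`, the other is summable over `K = 2 ^ j`. -/
theorem card_mul_exp_le (d : ℕ) {K : ℕ} (hK : 2 ≤ K) :
    ((cells d K).card : ℝ) * Real.exp (-logLevel d K) ≤ 1 / (K : ℝ) ^ 2 := by
  have hK0 : (0 : ℝ) < K := by exact_mod_cast (by omega : 0 < K)
  have h1 : Real.exp (-logLevel d K) = 1 / (K : ℝ) ^ (14 * (d ^ 2 + 2 * d) + 2) := by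
    unfold logLevel
    rw [Real.exp_neg, ← Real.log_pow, Real.exp_log (by positivity), one_div]
  have h2 : ((cells d K).card : ℝ) ≤ (K : ℝ) ^ (14 * (d ^ 2 + 2 * d)) := by
    exact_mod_cast card_cells_le d hK
  rw [h1, pow_add]
  calc ((cells d K).card : ℝ) * (1 / ((K : ℝ) ^ (14 * (d ^ 2 + 2 * d)) * (K : ℝ) ^ 2))
      ≤ (K : ℝ) ^ (14 * (d ^ 2 + 2 * d)) * (1 / ((K : ℝ) ^ (14 * (d ^ 2 + 2 * d)) * (K : ℝ) ^ 2)) := by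
        gcongr
    _ = 1 / (K : ℝ) ^ 2 := by field_simp

/-- The exponential supermartingale of a cell stays below its level. -/
def CellBound (M : LinearMDP S A d) (T t n K : ℕ) (z : ℕ → S × A × S) (c : ParamIdx d → ℤ) :
    Prop :=
  ∑ i ∈ Finset.range n, expTerm M t (netValue M ((T : ℝ) - (t + 1)) ((K : ℝ) ^ 8) c) T
    (fun x => Real.sqrt (logLevel d K) / T * (M.φ x ⬝ᵥ netDir ((K : ℝ) ^ 8) c)) (z i)
      < logLevel d K

end Net

/-! ### The good event -/

section GoodEvent

variable {S A Ω : Type*} [MeasurableSpace S] [MeasurableSpace A] [MeasurableSpace Ω] {d : ℕ}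

theorem measure_not_cellBound_le {Pr : Measure Ω} [IsProbabilityMeasure Pr]
    {M : LinearMDP S A d} {T n : ℕ} {Z : ℕ → ℕ → Ω → S × A × S} (hZ : Collected M Pr T n Z)
    {t : ℕ} (ht : t < T) (K : ℕ) (c : ParamIdx d → ℤ) :
    Pr {ω | ¬ CellBound M T t n K (fun i => Z t i ω) c} ≤
      ENNReal.ofReal (Real.exp (-logLevel d K)) := by
  have ht' : (t : ℝ) + 1 ≤ T := by exact_mod_cast ht
  unfold CellBound
  simp only [not_lt]
  refine measure_expTerm_sum_ge_le hZ ht (measurable_netValue M _ _ c) (fun s => ?_) ?_ _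
  · have := netValue_mem_Icc M (sub_nonneg.2 ht') ((K : ℝ) ^ 8) c s
    have h0 : (0 : ℝ) ≤ t := Nat.cast_nonneg t
    exact ⟨this.1, by linarith [this.2]⟩
  · unfold dotProduct
    have := measurable_φ_apply M
    fun_prop

/-- Uniform concentration over all scales, steps and cells. -/
theorem exists_good_event {Pr : Measure Ω} [IsProbabilityMeasure Pr]
    {M : LinearMDP S A d} {T n : ℕ} {Z : ℕ → ℕ → Ω → S × A × S} (hZ : Collected M Pr T n Z)
    {ξ : ℝ} (hξ : 0 < ξ) (hξ1 : ξ < 1) :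
    ∃ E : Set Ω, MeasurableSet E ∧ 1 - ξ ≤ Pr.real E ∧ ∀ ω ∈ E, ∀ j : ℕ,
      2 * (T : ℝ) / ξ ≤ 2 ^ j → ∀ t < T, ∀ c ∈ cells d (2 ^ j),
        CellBound M T t n (2 ^ j) (fun i => Z t i ω) c := by
  classical
  -- Scales below `2T/ξ` impose nothing, so the failure probabilities of the remaining ones form a
  -- geometric series of sum at most `ξ`.
  set bad : ℕ → Set Ω := fun j => ⋃ t ∈ Finset.range T, ⋃ c ∈ cells d (2 ^ j),
    {ω | 2 * (T : ℝ) / ξ ≤ 2 ^ j ∧ ¬ CellBound M T t n (2 ^ j) (fun i => Z t i ω) c} with hbad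
  have hj : ∀ j, Pr (bad j) ≤ ENNReal.ofReal (ξ / 2 * (1 / 2) ^ j) := by
    intro j
    by_cases hs : 2 * (T : ℝ) / ξ ≤ 2 ^ j
    · rcases Nat.eq_zero_or_pos T with rfl | hT
      · simp [hbad]
      have hT1 : (1 : ℝ) ≤ T := by exact_mod_cast hT
      have h2 : 2 ≤ 2 ^ j := by
        have : (2 : ℝ) < 2 ^ j := by
          refine lt_of_lt_of_le ?_ hs
          rw [lt_div_iff₀ hξ]
          nlinarith
        exact_mod_cast this.le
      calc Pr (bad j) ≤ ∑ t ∈ Finset.range T, ∑ c ∈ cells d (2 ^ j),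
            ENNReal.ofReal (Real.exp (-logLevel d (2 ^ j))) := by
            refine (measure_biUnion_finset_le _ _).trans (Finset.sum_le_sum fun t ht => ?_)
            refine (measure_biUnion_finset_le _ _).trans (Finset.sum_le_sum fun c _ => ?_)
            exact (measure_mono fun ω hω => hω.2).trans
              (measure_not_cellBound_le hZ (Finset.mem_range.1 ht) _ c)
        _ = ENNReal.ofReal (T * ((cells d (2 ^ j)).card *
              Real.exp (-logLevel d (2 ^ j)))) := by
            rw [Finset.sum_const, Finset.sum_const, Finset.card_range, nsmul_eq_mul, nsmul_eq_mul,
              ENNReal.ofReal_mul (Nat.cast_nonneg _), ENNReal.ofReal_mul (Nat.cast_nonneg _),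
              ENNReal.ofReal_natCast, ENNReal.ofReal_natCast]
        _ ≤ ENNReal.ofReal (ξ / 2 * (1 / 2) ^ j) := by
            apply ENNReal.ofReal_le_ofReal
            have h3 := card_mul_exp_le d h2
            push_cast at h3
            rw [div_le_iff₀ hξ] at hs
            have hp : (0 : ℝ) < 2 ^ j := by positivity
            calc (T : ℝ) * ((cells d (2 ^ j)).card * Real.exp (-logLevel d (2 ^ j)))
                ≤ T * (1 / (2 ^ j) ^ 2) := by gcongr
              _ ≤ (ξ / 2 * 2 ^ j) * (1 / (2 ^ j) ^ 2) := by
                  gcongr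
                  linarith
              _ = ξ / 2 * (1 / 2) ^ j := by
                  rw [one_div_pow]
                  field_simp
    · have : bad j = ∅ := by
        simp [hbad, hs]
      rw [this]
      simp
  have hB : Pr (⋃ j, bad j) ≤ ENNReal.ofReal ξ := by
    refine (measure_iUnion_le _).trans ((ENNReal.tsum_le_tsum hj).trans ?_)
    have hsum : HasSum (fun j : ℕ => ξ / 2 * (1 / 2) ^ j) ξ := by
      have := hasSum_geometric_two.mul_left (ξ / 2)
      rwa [div_mul_cancel₀ _ two_ne_zero] at this
    rw [← ENNReal.ofReal_tsum_of_nonneg (fun j => by positivity) hsum.summable, hsum.tsum_eq]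
  -- A measurable hull of the bad set has the same measure, so measurability of the individual
  -- failures need not be examined.
  refine ⟨(toMeasurable Pr (⋃ j, bad j))ᶜ, (measurableSet_toMeasurable _ _).compl, ?_, ?_⟩
  · rw [probReal_compl_eq_one_sub (measurableSet_toMeasurable _ _)]
    have : Pr.real (toMeasurable Pr (⋃ j, bad j)) ≤ ξ := by
      rw [measureReal_def, measure_toMeasurable]
      exact ENNReal.toReal_le_of_le_ofReal hξ.le hB
    linarith
  · intro ω hω j hs t ht c hc
    by_contra hcon
    refine hω (subset_toMeasurable _ _ (Set.mem_iUnion.2 ⟨j, ?_⟩))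
    simp only [hbad, Set.mem_iUnion]
    exact ⟨t, Finset.mem_range.2 ht, c, hc, hs, hcon⟩

end GoodEvent

/-! ### From grid cells to arbitrary value functions and directions -/

section Noise

variable {S A : Type*} [MeasurableSpace S] [MeasurableSpace A] {d : ℕ}

theorem one_le_logLevel (d : ℕ) {K : ℕ} (hK : 2 ≤ K) : 1 ≤ logLevel d K := by
  have h1 : (2 : ℝ) ≤ ((14 * (d ^ 2 + 2 * d) + 2 : ℕ) : ℝ) := by
    exact_mod_cast Nat.le_add_left _ _
  have h2 : Real.log 2 ≤ Real.log K := Real.log_le_log two_pos (by exact_mod_cast hK)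
  have h3 := Real.log_two_gt_d9
  unfold logLevel
  nlinarith

theorem logLevel_le {d : ℕ} (hd : 1 ≤ d) {K : ℕ} (hK : 2 ≤ K) :
    logLevel d K ≤ 44 * (d : ℝ) ^ 2 * Real.log K := by
  have h2 : 0 ≤ Real.log K := Real.log_nonneg (by exact_mod_cast (by omega : 1 ≤ K))
  unfold logLevel
  refine mul_le_mul_of_nonneg_right ?_ h2
  have : 14 * (d ^ 2 + 2 * d) + 2 ≤ 44 * d ^ 2 := by nlinarith
  exact_mod_cast this

theorem abs_sub_integral_le {X : Type*} [MeasurableSpace X] (ν : Measure X)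
    [IsProbabilityMeasure ν] {V : X → ℝ} (hV : Measurable V) {b : ℝ}
    (h : ∀ s, V s ∈ Set.Icc 0 b) (s : X) : |V s - ∫ s, V s ∂ν| ≤ b := by
  have h1 := integral_mem_Icc ν hV h
  have h2 := h s
  exact abs_le.2 ⟨by linarith [h1.2, h2.1], by linarith [h1.1, h2.2]⟩

theorem abs_integral_sub_le {X : Type*} [MeasurableSpace X] (ν : Measure X)
    [IsProbabilityMeasure ν] {V V' : X → ℝ} (hV : Measurable V) (hV' : Measurable V') {b e : ℝ}
    (h : ∀ s, V s ∈ Set.Icc 0 b) (h' : ∀ s, V' s ∈ Set.Icc 0 b) (he : ∀ s, |V s - V' s| ≤ e) :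
    |∫ s, V s ∂ν - ∫ s, V' s ∂ν| ≤ e := by
  rw [← integral_sub (Integrable.of_mem_Icc 0 b hV.aemeasurable (Filter.Eventually.of_forall h))
    (Integrable.of_mem_Icc 0 b hV'.aemeasurable (Filter.Eventually.of_forall h'))]
  exact abs_le.2 (integral_mem_Icc ν (hV.sub hV') fun s => abs_le.1 (he s))

/-- On the good event, the noise is controlled in every direction, for every value function with
bounded parameters. -/
theorem sum_noise_le {M : LinearMDP S A d} {T t n K : ℕ} (ht : t < T) (hK : 2 ≤ K)
    (hTK : (T : ℝ) ≤ K) (hnK : (n : ℝ) ≤ K) (hdK : (d : ℝ) ≤ K) {z : ℕ → S × A × S}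
    (hE : ∀ c ∈ cells d K, CellBound M T t n K z c) {V : S → ℝ} {w : Fin d → ℝ}
    {B : Matrix (Fin d) (Fin d) ℝ} (hV : IsValue M ((T : ℝ) - (t + 1)) w B V)
    (hw : ∀ j, |w j| ≤ (K : ℝ) ^ 4) (hB : ∀ i j, |B i j| ≤ (K : ℝ) ^ 4) {u : Fin d → ℝ}
    (hu : u ⬝ᵥ u ≤ K)
    (hG : ∑ i ∈ Finset.range n, (M.φ ((z i).1, (z i).2.1) ⬝ᵥ u) ^ 2 ≤ 1) :
    ∑ i ∈ Finset.range n, (V (z i).2.2 - ∫ s, V s ∂(M.P t ((z i).1, (z i).2.1))) *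
      (M.φ ((z i).1, (z i).2.1) ⬝ᵥ u) ≤ 6 * T * Real.sqrt (logLevel d K) := by
  have hmk := M.markov t
  have hK2 : (2 : ℝ) ≤ K := by exact_mod_cast hK
  have hT1 : (1 : ℝ) ≤ T := by exact_mod_cast (by omega : 1 ≤ T)
  have ht' : (t : ℝ) + 1 ≤ T := by exact_mod_cast ht
  have hK0 : (0 : ℝ) < K := by linarith
  have hR : (0 : ℝ) < (K : ℝ) ^ 8 := by positivity
  have hKK : (K : ℝ) ≤ (K : ℝ) ^ 2 := by nlinarith
  have hu2 : ∀ j, |u j| ≤ (K : ℝ) ^ 4 := fun j => by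
    have h1 : u j * u j ≤ u ⬝ᵥ u :=
      Finset.single_le_sum (f := fun i => u i * u i) (fun i _ => mul_self_nonneg _)
        (Finset.mem_univ j)
    refine abs_le_of_sq_le_sq (a := u j) ?_ (by positivity)
    have h2 : (K : ℝ) ≤ ((K : ℝ) ^ 4) ^ 2 := by
      rw [← pow_mul]; exact le_self_pow₀ (by linarith) (by norm_num)
    nlinarith
  set c := cellOf K w B u with hc
  have hcell := hE c (cellOf_mem hw hB hu2)
  set V' := netValue M ((T : ℝ) - (t + 1)) ((K : ℝ) ^ 8) c with hV'
  set u' := netDir ((K : ℝ) ^ 8) c with hu'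
  set x : ℕ → S × A := fun i => ((z i).1, (z i).2.1) with hx
  set L := logLevel d K with hL
  have hL1 : 1 ≤ L := one_le_logLevel d hK
  have hsL := Real.mul_self_sqrt (zero_le_one.trans hL1)
  have hsL1 : 1 ≤ Real.sqrt L := Real.one_le_sqrt.2 hL1
  have hVm := hV.measurable
  have hV'm : Measurable V' := measurable_netValue M _ _ c
  have hVI := fun s => hV.mem_Icc (sub_nonneg.2 ht') s
  have hV'I : ∀ s, V' s ∈ Set.Icc 0 ((T : ℝ) - (t + 1)) :=
    fun s => netValue_mem_Icc M (sub_nonneg.2 ht') _ c s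
  have hdK8 : (d : ℝ) / (K : ℝ) ^ 8 ≤ 1 / (K : ℝ) ^ 7 := by
    rw [div_le_div_iff₀ hR (by positivity)]
    calc (d : ℝ) * (K : ℝ) ^ 7 ≤ K * (K : ℝ) ^ 7 := by gcongr
      _ = 1 * (K : ℝ) ^ 8 := by ring
  have hε : ∀ s, |V s - V' s| ≤ 2 / (K : ℝ) ^ 3 := fun s => by
    refine (abs_sub_netValue_le hR hV (inCell_cellOf K w B u) s).trans ?_
    have h1 : Real.sqrt (1 / (K : ℝ) ^ 8) = 1 / (K : ℝ) ^ 4 := by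
      rw [show 1 / (K : ℝ) ^ 8 = (1 / (K : ℝ) ^ 4) ^ 2 by rw [div_pow, one_pow]; ring]
      exact Real.sqrt_sq (by positivity)
    have h2 : (d : ℝ) * (1 / (K : ℝ) ^ 4) ≤ 1 / (K : ℝ) ^ 3 := by
      rw [mul_one_div, div_le_div_iff₀ (by positivity) (by positivity)]
      calc (d : ℝ) * (K : ℝ) ^ 3 ≤ K * (K : ℝ) ^ 3 := by gcongr
        _ = 1 * (K : ℝ) ^ 4 := by ring
    have h3 : 1 / (K : ℝ) ^ 7 ≤ 1 / (K : ℝ) ^ 3 :=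
      one_div_le_one_div_of_le (by positivity) (pow_le_pow_right₀ (by linarith) (by norm_num))
    rw [h1]
    calc (d : ℝ) / (K : ℝ) ^ 8 + d * (1 / (K : ℝ) ^ 4)
        ≤ 1 / (K : ℝ) ^ 3 + 1 / (K : ℝ) ^ 3 := add_le_add (hdK8.trans h3) h2
      _ = 2 / (K : ℝ) ^ 3 := by ring
  set η : ℕ → ℝ := fun i => V (z i).2.2 - ∫ s, V s ∂(M.P t (x i)) with hη
  set η' : ℕ → ℝ := fun i => V' (z i).2.2 - ∫ s, V' s ∂(M.P t (x i)) with hη'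
  set a : ℕ → ℝ := fun i => M.φ (x i) ⬝ᵥ u with ha
  set a' : ℕ → ℝ := fun i => M.φ (x i) ⬝ᵥ u' with ha'
  have h1 : ∀ i, |η i - η' i| ≤ 4 / (K : ℝ) ^ 3 := fun i => by
    have e1 := hε (z i).2.2
    have e2 := abs_integral_sub_le (M.P t (x i)) hVm hV'm hVI hV'I hε
    have : η i - η' i = (V (z i).2.2 - V' (z i).2.2) -
        (∫ s, V s ∂(M.P t (x i)) - ∫ s, V' s ∂(M.P t (x i))) := by
      simp only [hη, hη']; ring
    rw [this]
    refine (abs_sub _ _).trans ((add_le_add e1 e2).trans_eq ?_)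
    ring
  have h2 : ∀ i, |a i| ≤ K := fun i => by
    refine abs_le_of_sq_le_sq (a := a i) ?_ hK0.le
    have := sq_dotProduct_le (M.φ (x i)) u
    have e1 := M.φ_norm_le (x i)
    have e2 := dotProduct_self_nonneg' u
    have e3 := dotProduct_self_nonneg' (M.φ (x i))
    nlinarith
  have h3 : ∀ i, |η' i| ≤ T := fun i => by
    refine (abs_sub_integral_le (M.P t (x i)) hV'm hV'I _).trans ?_
    linarith [(Nat.cast_nonneg t : (0 : ℝ) ≤ t)]
  have h4 : ∀ i, |a i - a' i| ≤ 1 / (K : ℝ) ^ 7 := fun i => by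
    simp only [ha, ha']
    rw [← dotProduct_sub]
    refine (abs_φ_dotProduct_le M (x i) fun j =>
      abs_sub_netDir_le (by omega : 0 < K) w B u j).trans ?_
    rw [mul_one_div]
    exact hdK8
  -- Replacing value function and direction by those of the cell costs `5 / K²` per transition,
  -- hence at most `5 / K ≤ 3` over `n ≤ K` transitions.
  have h5 : ∀ i, η i * a i ≤ a' i * η' i + 5 / (K : ℝ) ^ 2 := fun i => by
    have e1 : η i * a i = a' i * η' i + (η i - η' i) * a i + η' i * (a i - a' i) := by ring
    have e2 : (η i - η' i) * a i ≤ 4 / (K : ℝ) ^ 2 := by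
      refine (le_abs_self _).trans ?_
      rw [abs_mul]
      calc |η i - η' i| * |a i| ≤ 4 / (K : ℝ) ^ 3 * K := by
            gcongr
            · exact h1 i
            · exact h2 i
        _ = 4 / (K : ℝ) ^ 2 := by field_simp
    have e3 : η' i * (a i - a' i) ≤ 1 / (K : ℝ) ^ 2 := by
      refine (le_abs_self _).trans ?_
      rw [abs_mul]
      calc |η' i| * |a i - a' i| ≤ K * (1 / (K : ℝ) ^ 7) := by
            gcongr
            · exact (h3 i).trans hTK
            · exact h4 i
        _ = 1 / (K : ℝ) ^ 6 := by field_simp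
        _ ≤ 1 / (K : ℝ) ^ 2 :=
          one_div_le_one_div_of_le (by positivity) (pow_le_pow_right₀ (by linarith) (by norm_num))
    calc η i * a i = a' i * η' i + (η i - η' i) * a i + η' i * (a i - a' i) := e1
      _ ≤ a' i * η' i + 4 / (K : ℝ) ^ 2 + 1 / (K : ℝ) ^ 2 := by linarith
      _ = _ := by ring
  have h6 : ∑ i ∈ Finset.range n, η i * a i ≤ ∑ i ∈ Finset.range n, a' i * η' i + 3 := by
    refine (Finset.sum_le_sum fun i _ => h5 i).trans ?_
    rw [Finset.sum_add_distrib, Finset.sum_const, Finset.card_range, nsmul_eq_mul]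
    have : (n : ℝ) * (5 / (K : ℝ) ^ 2) ≤ 3 := by
      rw [mul_div_assoc', div_le_iff₀ (by positivity)]
      nlinarith
    linarith
  -- The grid direction loses exact normalization; `a'² ≤ 2 a² + 2 (a - a')²` gives `2 + 1`.
  have h7 : ∑ i ∈ Finset.range n, a' i ^ 2 ≤ 3 := by
    have e1 : ∀ i ∈ Finset.range n, a' i ^ 2 ≤ 2 * a i ^ 2 + 2 * (1 / (K : ℝ) ^ 2) := fun i _ => by
      have e2 : (a i - a' i) ^ 2 ≤ (1 / (K : ℝ) ^ 7) ^ 2 := by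
        rw [← sq_abs]
        exact pow_le_pow_left₀ (abs_nonneg _) (h4 i) 2
      have e3 : (1 / (K : ℝ) ^ 7) ^ 2 ≤ 1 / (K : ℝ) ^ 2 := by
        rw [div_pow, one_pow, ← pow_mul]
        exact one_div_le_one_div_of_le (by positivity)
          (pow_le_pow_right₀ (by linarith) (by norm_num))
      nlinarith [sq_nonneg (2 * a i - a' i)]
    refine (Finset.sum_le_sum e1).trans ?_
    rw [Finset.sum_add_distrib, ← Finset.mul_sum, Finset.sum_const, Finset.card_range, nsmul_eq_mul]
    have : (n : ℝ) * (2 * (1 / (K : ℝ) ^ 2)) ≤ 1 := by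
      rw [mul_one_div, mul_div_assoc', div_le_one (by positivity)]
      nlinarith
    linarith
  -- The multiplier `√L / T` turns the quadratic compensator with range `T` into `L/2` times the sum
  -- of squares. The right side is thus at most `5 L / 2`, and division by the multiplier leaves
  -- order `T √L`.
  have h8 : Real.sqrt L / T * ∑ i ∈ Finset.range n, a' i * η' i ≤
      L + L / 2 * ∑ i ∈ Finset.range n, a' i ^ 2 := by
    have e1 : ∀ i, expTerm M t V' T (fun x => Real.sqrt L / T * (M.φ x ⬝ᵥ u')) (z i) =
        Real.sqrt L / T * (a' i * η' i) - L / 2 * a' i ^ 2 := fun i => by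
      have e2 : expTerm M t V' T (fun x => Real.sqrt L / T * (M.φ x ⬝ᵥ u')) (z i) =
        Real.sqrt L / T * a' i * η' i - (Real.sqrt L / T * a' i) ^ 2 * (T : ℝ) ^ 2 / 2 := rfl
      rw [e2, mul_pow, div_pow, Real.sq_sqrt (zero_le_one.trans hL1)]
      field_simp
    have e3 : ∑ i ∈ Finset.range n,
      expTerm M t V' T (fun x => Real.sqrt L / T * (M.φ x ⬝ᵥ u')) (z i) < L := hcell
    simp only [e1] at e3
    rw [Finset.sum_sub_distrib, ← Finset.mul_sum, ← Finset.mul_sum] at e3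
    linarith
  have h9 : ∑ i ∈ Finset.range n, a' i * η' i ≤ 5 / 2 * (T * Real.sqrt L) := by
    have e1 : Real.sqrt L / T * ∑ i ∈ Finset.range n, a' i * η' i ≤ 5 / 2 * L := by nlinarith
    have e2 : 0 < Real.sqrt L / T := by positivity
    have e3 : 5 / 2 * L = Real.sqrt L / T * (5 / 2 * (T * Real.sqrt L)) := by
      field_simp
      nlinarith
    rw [e3] at e1
    exact le_of_mul_le_mul_left e1 e2
  have h10 : 1 ≤ T * Real.sqrt L := one_le_mul_of_one_le_of_one_le hT1 hsL1
  calc ∑ i ∈ Finset.range n, η i * a i ≤ 5 / 2 * (T * Real.sqrt L) + 3 := by linarith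
    _ ≤ 6 * T * Real.sqrt L := by linarith

end Noise

/-! ### Regression error and polynomial bounds on the parameters -/

section Regression

variable {S A : Type*} [MeasurableSpace S] [MeasurableSpace A] {d : ℕ}

/-- The minimizer of a least squares problem is controlled by its targets. -/
theorem form_minimizer_le (l : List (Row d)) (hl : ∀ z ∈ l, 0 ≤ z.1) {w : Fin d → ℝ}
    (h : ∀ w', squaredLoss l w ≤ squaredLoss l w') :
    w ⬝ᵥ (gram l *ᵥ w) ≤ squaredLoss l 0 := by
  -- The step `-w` from the minimizer leads to `0`; the linear term vanishes, so the loss at `0` is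
  -- the minimal loss plus the form at `w`.
  have h1 := squaredLoss_add l w w (-1)
  rw [normal_equations l h w] at h1
  have h2 : w + (-1 : ℝ) • w = 0 := by simp
  rw [h2] at h1
  have h3 : 0 ≤ squaredLoss l w := by
    apply List.sum_nonneg
    intro a ha
    obtain ⟨z, hz, rfl⟩ := List.mem_map.1 ha
    exact mul_nonneg (hl z hz) (sq_nonneg _)
  linarith

theorem loss_zero_eq (M : LinearMDP S A d) (t : ℕ) (D : StepData S A) (V : S → ℝ) :
    loss M t D V 0 = (D.samples.map fun z => (M.r t (z.s, z.a) + V z.s') ^ 2).sum +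
      (D.ood.map fun z => z.2.2 ^ 2).sum := by
  simp [loss]

theorem list_sum_map_le {ι : Type*} (l : List ι) (f : ι → ℝ) {C : ℝ} (h : ∀ i, f i ≤ C) :
    (l.map f).sum ≤ l.length * C := by
  induction l with
  | nil => simp
  | cons a l ih =>
    simp only [List.map_cons, List.sum_cons, List.length_cons, Nat.cast_add, Nat.cast_one]
    linarith [h a]

/-- The OOD targets are arbitrary reals; they are compared with the bounded Bellman targets through
`ŷ² ≤ 2 (ŷ - q)² + 2 q²`, with `q` the Bellman target. This leaves `oodError`, which the penalty
coefficient dominates. -/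
theorem loss_zero_le (M : LinearMDP S A d) (t : ℕ) (D : StepData S A) {V : S → ℝ}
    (hV : Measurable V) {b : ℝ} (hb : ∀ s, V s ∈ Set.Icc 0 b) :
    loss M t D V 0 ≤ D.samples.length * (1 + b) ^ 2 + 2 * oodError M t D V ^ 2 +
      D.ood.length * (2 * (1 + b) ^ 2) := by
  rw [loss_zero_eq]
  have h1 := list_sum_map_le D.samples (fun z => (M.r t (z.s, z.a) + V z.s') ^ 2)
    (C := (1 + b) ^ 2) fun z => by
      have h1 := M.r_mem t (z.s, z.a)
      have h2 := hb z.s'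
      exact pow_le_pow_left₀ (add_nonneg h1.1 h2.1) (add_le_add h1.2 h2.2) 2
  have h2 : oodError M t D V ^ 2 =
      (D.ood.map fun z => (z.2.2 - bellman M t V (z.1, z.2.1)) ^ 2).sum := by
    refine Real.sq_sqrt (List.sum_nonneg fun a ha => ?_)
    obtain ⟨z, _, rfl⟩ := List.mem_map.1 ha
    exact sq_nonneg _
  have h3 := list_sum_map_le D.ood
    (fun z => z.2.2 ^ 2 - 2 * (z.2.2 - bellman M t V (z.1, z.2.1)) ^ 2)
    (C := 2 * (1 + b) ^ 2) fun z => by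
      have h1 := bellman_mem_Icc M t hV hb (z.1, z.2.1)
      have h2 := pow_le_pow_left₀ h1.1 h1.2 2
      nlinarith [sq_nonneg (z.2.2 - 2 * bellman M t V (z.1, z.2.1))]
  have h4 : (D.ood.map fun z => z.2.2 ^ 2 - 2 * (z.2.2 - bellman M t V (z.1, z.2.1)) ^ 2).sum =
      (D.ood.map fun z => z.2.2 ^ 2).sum -
        2 * (D.ood.map fun z => (z.2.2 - bellman M t V (z.1, z.2.1)) ^ 2).sum := by
    induction D.ood with
    | nil => simp
    | cons a l ih => simp only [List.map_cons, List.sum_cons] at ih ⊢; rw [ih]; ring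
  rw [h2]
  linarith

/-- The covariance form, split into its three parts. -/
theorem dotProduct_cov (M : LinearMDP S A d) (D : StepData S A) (y : Fin d → ℝ) :
    y ⬝ᵥ (cov M D *ᵥ y) = (D.samples.map fun z => (M.φ (z.s, z.a) ⬝ᵥ y) ^ 2).sum +
      (D.ood.map fun z => (M.φ (z.1, z.2.1) ⬝ᵥ y) ^ 2).sum +
      ((advPairs D).map fun p => 1 / (p.1.adv.length : ℝ) *
        ((M.φ (p.2, p.1.a) - M.φ (p.1.s, p.1.a)) ⬝ᵥ y) ^ 2).sum := by
  rw [← gram_rows M 0 D 0, dotProduct_gram]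
  simp [rows, inRows, oodRows, robustRows, Function.comp_def, pow_two, add_assoc]

theorem smoothError_eq (M : LinearMDP S A d) (t : ℕ) (D : StepData S A) (V : S → ℝ) :
    smoothError M t D V = Real.sqrt ((advPairs D).map fun p => 1 / (p.1.adv.length : ℝ) *
      (bellman M t V (p.2, p.1.a) - bellman M t V (p.1.s, p.1.a)) ^ 2).sum := by
  have := advPairs_sum D (fun z => 1 / (z.adv.length : ℝ))
    (fun z sh => (bellman M t V (sh, z.a) - bellman M t V (z.s, z.a)) ^ 2)
  simp only [smul_eq_mul] at this
  rw [← this]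
  rfl

theorem list_map_sum_nonneg {ι : Type*} (l : List ι) {f : ι → ℝ} (h : ∀ i, 0 ≤ f i) :
    0 ≤ (l.map f).sum := by
  refine List.sum_nonneg fun a ha => ?_
  obtain ⟨z, _, rfl⟩ := List.mem_map.1 ha
  exact h z

/-- Error of the regression: noise, OOD target error and smoothing bias. -/
theorem form_error_le (M : LinearMDP S A d) (t : ℕ) (D : StepData S A) {V : S → ℝ}
    {w v : Fin d → ℝ} (hw : ∀ w', loss M t D V w ≤ loss M t D V w')
    (hv : ∀ x, bellman M t V x = M.φ x ⬝ᵥ v) :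
    (w - v) ⬝ᵥ (cov M D *ᵥ (w - v)) ≤
      (D.samples.map fun z => (V z.s' - ∫ s, V s ∂(M.P t (z.s, z.a))) *
        (M.φ (z.s, z.a) ⬝ᵥ (w - v))).sum +
      (oodError M t D V + smoothError M t D V) *
        Real.sqrt ((w - v) ⬝ᵥ (cov M D *ᵥ (w - v))) := by
  set y := w - v with hy
  -- At the true coefficients the residuals are the transition noise, the OOD target error, and
  -- minus the variation of the Bellman target.
  have h0 := gram_mulVec_sub_eq (rows M t D V) (w := w)
    (by rw [squaredLoss_rows]; exact hw) v y
  rw [gram_rows] at h0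
  simp only [rows, inRows, oodRows, robustRows, List.map_append, List.sum_append, List.map_map,
    Function.comp_def, one_mul] at h0
  have hq := dotProduct_cov M D y
  have n1 := list_map_sum_nonneg D.samples (fun z => sq_nonneg (M.φ (z.s, z.a) ⬝ᵥ y))
  have n2 := list_map_sum_nonneg D.ood (fun z => sq_nonneg (M.φ (z.1, z.2.1) ⬝ᵥ y))
  have n3 := list_map_sum_nonneg (advPairs D) (fun p => mul_nonneg
    (show 0 ≤ 1 / (p.1.adv.length : ℝ) by positivity)
    (sq_nonneg ((M.φ (p.2, p.1.a) - M.φ (p.1.s, p.1.a)) ⬝ᵥ y)))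
  have h1 : (D.samples.map fun z => (M.r t (z.s, z.a) + V z.s' - M.φ (z.s, z.a) ⬝ᵥ v) *
      (M.φ (z.s, z.a) ⬝ᵥ y)) = D.samples.map fun z =>
        (V z.s' - ∫ s, V s ∂(M.P t (z.s, z.a))) * (M.φ (z.s, z.a) ⬝ᵥ y) := by
    refine List.map_congr_left fun z _ => ?_
    rw [← hv, bellman]
    ring
  have h2 := list_sum_mul_le D.ood (fun _ => 1) (fun z => z.2.2 - M.φ (z.1, z.2.1) ⬝ᵥ v)
    (fun z => M.φ (z.1, z.2.1) ⬝ᵥ y) (fun _ => zero_le_one)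
  simp only [one_mul] at h2
  have h3 := list_sum_mul_le (advPairs D) (fun p => 1 / (p.1.adv.length : ℝ))
    (fun p => 0 - (M.φ (p.2, p.1.a) - M.φ (p.1.s, p.1.a)) ⬝ᵥ v)
    (fun p => (M.φ (p.2, p.1.a) - M.φ (p.1.s, p.1.a)) ⬝ᵥ y) (fun _ => by positivity)
  have e2 : oodError M t D V =
      Real.sqrt (D.ood.map fun z => (z.2.2 - M.φ (z.1, z.2.1) ⬝ᵥ v) ^ 2).sum := by
    simp only [oodError, hv]
  have e3 : smoothError M t D V = Real.sqrt ((advPairs D).map fun p =>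
      1 / (p.1.adv.length : ℝ) *
        (0 - (M.φ (p.2, p.1.a) - M.φ (p.1.s, p.1.a)) ⬝ᵥ v) ^ 2).sum := by
    rw [smoothError_eq]
    simp only [hv, zero_sub, neg_sq, sub_dotProduct]
  rw [← e2] at h2
  rw [← e3] at h3
  -- Each of the three parts of the covariance form is nonnegative, so any one of them is bounded by
  -- the whole.
  have s2 := mul_le_mul_of_nonneg_left (Real.sqrt_le_sqrt
    (show (D.ood.map fun z => (M.φ (z.1, z.2.1) ⬝ᵥ y) ^ 2).sum ≤ y ⬝ᵥ (cov M D *ᵥ y) by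
      rw [hq]; linarith [n1, n3])) (Real.sqrt_nonneg _ : 0 ≤ oodError M t D V)
  have s3 := mul_le_mul_of_nonneg_left (Real.sqrt_le_sqrt
    (show ((advPairs D).map fun p => 1 / (p.1.adv.length : ℝ) *
        ((M.φ (p.2, p.1.a) - M.φ (p.1.s, p.1.a)) ⬝ᵥ y) ^ 2).sum ≤ y ⬝ᵥ (cov M D *ᵥ y) by
      rw [hq]; linarith [n1, n2])) (Real.sqrt_nonneg _ : 0 ≤ smoothError M t D V)
  rw [h1, ← hy] at h0
  rw [add_mul, ← add_assoc]
  refine h0.trans_le ?_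
  exact add_le_add (add_le_add le_rfl (h2.trans s2)) (h3.trans s3)

/-- Entries of the inverse of a coercive matrix. -/
theorem abs_inv_apply_le {Λ : Matrix (Fin d) (Fin d) ℝ} (h : Λ.PosDef) {ε : ℝ} (hε : 0 < ε)
    (hΛ : ∀ y : Fin d → ℝ, ε * (y ⬝ᵥ y) ≤ y ⬝ᵥ (Λ *ᵥ y)) (i j : Fin d) :
    |Λ⁻¹ i j| ≤ 1 / ε := by
  -- For the `j`-th column `y` of the inverse, coercivity reads `ε |y|² ≤ y_j`. It bounds first
  -- `y_j` by `1/ε`, then every other entry.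
  set y : Fin d → ℝ := Λ⁻¹ *ᵥ Pi.single j 1 with hy
  have hyi : ∀ i, y i = Λ⁻¹ i j := fun i => by simp [hy]
  have h1 := hΛ y
  have h2 : y ⬝ᵥ (Λ *ᵥ y) = y j := by
    rw [hy, mulVec_inv_cancel h]
    simp
  rw [h2] at h1
  have hle : ∀ i, y i * y i ≤ y ⬝ᵥ y := fun i =>
    Finset.single_le_sum (f := fun i => y i * y i) (fun i _ => mul_self_nonneg _)
      (Finset.mem_univ i)
  have h3 : ε * (y j * y j) ≤ y j := (mul_le_mul_of_nonneg_left (hle j) hε.le).trans h1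
  have h4 : 0 ≤ y j := le_trans (mul_nonneg hε.le (mul_self_nonneg _)) h3
  have h5 : ε * y j ≤ 1 := by
    by_contra hcon
    push Not at hcon
    have : 0 < y j := by nlinarith
    nlinarith
  have h6 := mul_le_mul_of_nonneg_left (hle i) hε.le
  rw [← hyi]
  refine abs_le_of_sq_le_sq (a := y i) ?_ (by positivity)
  have h7 : y j ≤ 1 / ε := by rw [le_div_iff₀ hε]; linarith
  have h8 : ε * (y i) ^ 2 ≤ 1 / ε := by nlinarith
  have h9 : (y i) ^ 2 ≤ 1 / ε / ε := by rw [le_div_iff₀ hε]; linarith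
  refine h9.trans_eq ?_
  rw [div_pow, one_pow]
  field_simp

/-- The values of a run are attained maxima of truncated action values. -/
theorem Run.isValue {M : LinearMDP S A d} {T : ℕ} {D : ℕ → StepData S A} {α : ℕ → ℝ}
    (R : Run M T D α) {t : ℕ} (ht : t < T) (hα : 0 ≤ α t) :
    IsValue M ((T : ℝ) - t) (R.w t) (α t ^ 2 • (cov M (D t))⁻¹) (R.V t) := by
  have h : ∀ x, truncQ M ((T : ℝ) - t) (R.w t) (α t ^ 2 • (cov M (D t))⁻¹) x =
      pessQ M T t (α t) (D t) (R.w t) x := fun x => by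
    unfold truncQ pessQ uncertainty
    rw [Matrix.smul_mulVec, dotProduct_smul, smul_eq_mul, Real.sqrt_mul (sq_nonneg _),
      Real.sqrt_sq hα]
  refine ⟨R.measurable_V ht.le, fun s a => ?_, fun s => ⟨R.π t s, ?_⟩⟩
  · rw [h, R.value t ht]
    exact R.greedy t ht s a
  · rw [h, R.value t ht]

/-- The zero terminal value belongs to the same class with cap `0`, so the last regression is
covered by the same grid argument. -/
theorem Run.isValue_terminal {M : LinearMDP S A d} {T : ℕ} {D : ℕ → StepData S A} {α : ℕ → ℝ}
    (R : Run M T D α) : IsValue M 0 0 0 (R.V T) := by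
  have h : ∀ x, truncQ M 0 0 0 x = 0 := fun x => by simp [truncQ]
  refine ⟨R.measurable_V le_rfl, fun s a => ?_, fun s => ⟨R.π T s, ?_⟩⟩ <;>
  · rw [h, R.terminal]

/-- A scale `K` that dominates every quantity in the logarithm. -/
structure Dominates (M : LinearMDP S A d) (T n : ℕ) (D : ℕ → StepData S A) (α : ℕ → ℝ)
    (K : ℕ) : Prop where
  two_le : 2 ≤ K
  horizon : (T : ℝ) ≤ K
  dim : (d : ℝ) ≤ K
  samples : (n : ℝ) ≤ K
  ood : ∀ t < T, ((D t).ood.length : ℝ) ≤ K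
  coeff : ∀ t < T, α t ≤ K
  eig : 1 / minEig M T D ≤ K

/-- The parameters of a run are polynomially bounded. -/
theorem Run.exists_isValue {M : LinearMDP S A d} {T n K : ℕ} {D : ℕ → StepData S A} {α : ℕ → ℝ}
    (R : Run M T D α) (hK : Dominates M T n D α K) (hn : ∀ t, (D t).samples.length = n)
    (hpd : ∀ t < T, (cov M (D t)).PosDef) (hmin : 0 < minEig M T D)
    (hα : ∀ t < T, oodError M t (D t) (R.V (t + 1)) ≤ α t) {t : ℕ} (ht : t < T) :
    ∃ w B, IsValue M ((T : ℝ) - (t + 1)) w B (R.V (t + 1)) ∧ (∀ j, |w j| ≤ (K : ℝ) ^ 4) ∧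
      ∀ i j, |B i j| ≤ (K : ℝ) ^ 4 := by
  have hK2 : (2 : ℝ) ≤ K := by exact_mod_cast hK.two_le
  have hK0 : (0 : ℝ) < K := by linarith
  rcases (show t + 1 ≤ T from ht).lt_or_eq with h1 | h1
  swap
  · refine ⟨0, 0, ?_, fun j => ?_, fun i j => ?_⟩
    · have : (T : ℝ) - (t + 1) = 0 := by rw [← h1]; push_cast; ring
      rw [this, h1]
      exact R.isValue_terminal
    · simp only [Pi.zero_apply, abs_zero]; positivity
    · simp only [Matrix.zero_apply, abs_zero]; positivity
  -- The value used in the regression at step `t` is produced at step `t + 1`, so its parameters are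
  -- the ones to be bounded.
  set τ := t + 1 with hτ
  have ho := hα τ h1
  have ho0 : 0 ≤ oodError M τ (D τ) (R.V (τ + 1)) := Real.sqrt_nonneg _
  have hα0 : 0 ≤ α τ := ho0.trans ho
  have hαK := hK.coeff τ h1
  refine ⟨R.w τ, α τ ^ 2 • (cov M (D τ))⁻¹, ?_, fun j => ?_, fun i j => ?_⟩
  · have := R.isValue h1 hα0
    rw [hτ] at this ⊢
    push_cast at this
    exact this
  · have hwl := form_minimizer_le (rows M τ (D τ) (R.V (τ + 1))) (rows_nonneg _ _ _ _)
      (w := R.w τ) (by rw [squaredLoss_rows]; exact R.regression τ h1)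
    rw [gram_rows, squaredLoss_rows] at hwl
    have hlo := loss_zero_le M τ (D τ) (R.measurable_V (show τ + 1 ≤ T from h1))
      (R.value_mem (show τ + 1 ≤ T from h1))
    have hb1 : 1 + ((T : ℝ) - ((τ + 1 : ℕ) : ℝ)) ≤ K := by
      push_cast
      linarith [hK.horizon, (Nat.cast_nonneg τ : (0 : ℝ) ≤ τ)]
    have hb0 : 0 ≤ 1 + ((T : ℝ) - ((τ + 1 : ℕ) : ℝ)) := by
      have : ((τ + 1 : ℕ) : ℝ) ≤ T := by exact_mod_cast h1
      linarith
    have hb := pow_le_pow_left₀ hb0 hb1 2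
    have hoK := pow_le_pow_left₀ ho0 (ho.trans hαK) 2
    rw [hn τ] at hlo
    have hL : loss M τ (D τ) (R.V (τ + 1)) 0 ≤ K * (K : ℝ) ^ 2 + 2 * (K : ℝ) ^ 2 +
        K * (2 * (K : ℝ) ^ 2) := by
      refine hlo.trans ?_
      gcongr
      · exact_mod_cast hK.samples
      · exact_mod_cast hK.ood τ h1
    have hmin2 := minEig_mul_le M D hpd h1 (R.w τ)
    -- The smallest eigenvalue times `|w|²` is at most `wᵀΛw`, hence at most the loss at zero.
    have h2 : R.w τ ⬝ᵥ R.w τ ≤ K * (K * (K : ℝ) ^ 2 + 2 * (K : ℝ) ^ 2 + K * (2 * (K : ℝ) ^ 2)) := by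
      have h3 : R.w τ ⬝ᵥ R.w τ = 1 / minEig M T D * (minEig M T D * (R.w τ ⬝ᵥ R.w τ)) := by
        field_simp
      rw [h3]
      exact mul_le_mul hK.eig (hmin2.trans (hwl.trans hL))
        (mul_nonneg hmin.le (dotProduct_self_nonneg' _)) hK0.le
    have h3 : R.w τ j * R.w τ j ≤ R.w τ ⬝ᵥ R.w τ :=
      Finset.single_le_sum (f := fun i => R.w τ i * R.w τ i) (fun i _ => mul_self_nonneg _)
        (Finset.mem_univ j)
    refine abs_le_of_sq_le_sq (a := R.w τ j) ?_ (by positivity)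
    have h4 : (K : ℝ) * (K * (K : ℝ) ^ 2 + 2 * (K : ℝ) ^ 2 + K * (2 * (K : ℝ) ^ 2)) ≤
        ((K : ℝ) ^ 4) ^ 2 := by
      have e1 : 2 * (K : ℝ) ^ 3 ≤ (K : ℝ) ^ 4 := by
        have := mul_le_mul_of_nonneg_right hK2 (by positivity : (0 : ℝ) ≤ (K : ℝ) ^ 3)
        linarith [this, (by ring : (K : ℝ) * (K : ℝ) ^ 3 = (K : ℝ) ^ 4)]
      have e2 : (16 : ℝ) ≤ (K : ℝ) ^ 4 := by
        have := pow_le_pow_left₀ (by norm_num : (0 : ℝ) ≤ 2) hK2 4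
        linarith
      have e3 := mul_le_mul_of_nonneg_right e2 (by positivity : (0 : ℝ) ≤ (K : ℝ) ^ 4)
      nlinarith
    nlinarith
  · rw [Matrix.smul_apply, smul_eq_mul, abs_mul, abs_of_nonneg (sq_nonneg _)]
    have h2 := (abs_inv_apply_le (hpd τ h1) hmin (minEig_mul_le M D hpd h1) i j).trans hK.eig
    have h3 := pow_le_pow_left₀ hα0 hαK 2
    calc α τ ^ 2 * |(cov M (D τ))⁻¹ i j| ≤ (K : ℝ) ^ 2 * K := by gcongr
      _ ≤ (K : ℝ) ^ 4 := by
        rw [← pow_succ]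
        exact pow_le_pow_right₀ (by linarith) (by norm_num)

omit [MeasurableSpace S] [MeasurableSpace A] in
theorem sum_mkData_samples {X : Type*} [AddCommMonoid X] (n : ℕ) (z : ℕ → S × A × S)
    (adv : ℕ → List S) (ood : List (S × A × ℝ)) (f : S → A → S → X) :
    ((mkData (List.range n) z adv ood).samples.map fun q => f q.s q.a q.s').sum =
      ∑ i ∈ Finset.range n, f (z i).1 (z i).2.1 (z i).2.2 := by
  unfold mkData
  rw [List.map_map, Finset.sum_range, ← List.sum_ofFn, List.ofFn_eq_map]
  simp [Function.comp_def, ← List.map_coe_finRange_eq_range,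
    List.map_map]

/-- On the good event, the regression error is at most the width times the uncertainty. -/
theorem abs_regression_error_le {M : LinearMDP S A d} (hd : 1 ≤ d) {T n K : ℕ}
    {D : ℕ → StepData S A} {α : ℕ → ℝ} {z : ℕ → ℕ → S × A × S} {adv : ℕ → ℕ → List S}
    {ood : ℕ → List (S × A × ℝ)} (hD : ∀ t, D t = mkData (List.range n) (z t) (adv t) (ood t))
    (R : Run M T D α) (hK : Dominates M T n D α K)
    (hpd : ∀ t < T, (cov M (D t)).PosDef)
    (hα : ∀ t < T, oodError M t (D t) (R.V (t + 1)) ≤ α t) {t : ℕ} (ht : t < T)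
    (hE : ∀ c ∈ cells d K, CellBound M T t n K (z t) c) (x : S × A) :
    |M.φ x ⬝ᵥ R.w t - bellman M t (R.V (t + 1)) x| ≤
      (6 * T * Real.sqrt (logLevel d K) + oodError M t (D t) (R.V (t + 1)) +
        smoothError M t (D t) (R.V (t + 1))) * uncertainty M (D t) x := by
  have hne : Nonempty (Fin d) := ⟨⟨0, hd⟩⟩
  have hmin : 0 < minEig M T D := minEig_pos M (Nat.zero_lt_of_lt ht) D hpd
  have hlen : ∀ t, (D t).samples.length = n := fun t => by rw [hD]; simp [mkData]
  have hVm := R.measurable_V (show t + 1 ≤ T from ht)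
  have hVI := R.value_mem (show t + 1 ≤ T from ht)
  obtain ⟨v, hv⟩ := exists_bellman_eq M t hVm (C := (T : ℝ) - ((t + 1 : ℕ) : ℝ))
    fun s => by rw [abs_of_nonneg (hVI s).1]; exact (hVI s).2
  obtain ⟨w, B, hval, hw, hB⟩ := R.exists_isValue hK hlen hpd hmin hα ht
  set y := R.w t - v with hy
  set q := y ⬝ᵥ (cov M (D t) *ᵥ y) with hq
  set r := Real.sqrt q with hr
  have hq0 : 0 ≤ q := by
    simpa using (cov_posSemidef M (D t)).dotProduct_mulVec_nonneg y
  have hrr : r * r = q := Real.mul_self_sqrt hq0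
  have hr0 : 0 ≤ r := Real.sqrt_nonneg _
  have herr := form_error_le M t (D t) (R.regression t ht) hv
  rw [← hy, ← hq, ← hr] at herr
  have hcs := abs_dotProduct_le (hpd t ht) (M.φ x) y
  rw [← hq, ← hr] at hcs
  have hU := uncertainty_nonneg M (D t) x
  have e0 : 0 ≤ oodError M t (D t) (R.V (t + 1)) := Real.sqrt_nonneg _
  have e1 : 0 ≤ smoothError M t (D t) (R.V (t + 1)) := Real.sqrt_nonneg _
  have e2 : 0 ≤ 6 * T * Real.sqrt (logLevel d K) := by positivity
  rw [hv, ← dotProduct_sub, ← hy]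
  refine hcs.trans ?_
  rw [mul_comm]
  refine mul_le_mul_of_nonneg_right ?_ hU
  rcases hr0.lt_or_eq with hrpos | hr0'
  -- A zero error in `Λ`-norm leaves nothing to prove; otherwise the error can be normalized.
  swap
  · rw [← hr0']; positivity
  have hsum : ((D t).samples.map fun z => (R.V (t + 1) z.s' -
      ∫ s, R.V (t + 1) s ∂(M.P t (z.s, z.a))) * (M.φ (z.s, z.a) ⬝ᵥ y)).sum =
      ∑ i ∈ Finset.range n, (R.V (t + 1) (z t i).2.2 -
        ∫ s, R.V (t + 1) s ∂(M.P t ((z t i).1, (z t i).2.1))) *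
          (M.φ ((z t i).1, (z t i).2.1) ⬝ᵥ y) := by
    rw [hD t]
    exact sum_mkData_samples n (z t) (adv t) (ood t) fun s a s' =>
      (R.V (t + 1) s' - ∫ s, R.V (t + 1) s ∂(M.P t (s, a))) * (M.φ (s, a) ⬝ᵥ y)
  have hGsum : ∑ i ∈ Finset.range n, (M.φ ((z t i).1, (z t i).2.1) ⬝ᵥ y) ^ 2 ≤ q := by
    rw [hq, dotProduct_cov, hD t]
    rw [sum_mkData_samples n (z t) (adv t) (ood t) fun s a _ => (M.φ (s, a) ⬝ᵥ y) ^ 2]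
    rw [add_assoc]
    refine le_add_of_nonneg_right (add_nonneg ?_ ?_)
    · exact list_map_sum_nonneg _ fun z => sq_nonneg _
    · exact list_map_sum_nonneg _ fun z => mul_nonneg (by positivity) (sq_nonneg _)
  -- The direction `y / r` has squared length at most `1/λ ≤ K`. The covariance of the transitions
  -- is only a part of `Λ`, so the squared features along it sum to at most one.
  have hnoise := sum_noise_le ht hK.two_le hK.horizon hK.samples hK.dim hE hval hw hB
    (u := r⁻¹ • y)
    (by
      rw [smul_dotProduct, dotProduct_smul, smul_eq_mul, smul_eq_mul, ← mul_assoc, ← mul_inv, hrr]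
      have hqpos : 0 < q := by rw [← hrr]; positivity
      rw [inv_mul_eq_div, div_le_iff₀ hqpos]
      have h1 := minEig_mul_le M D hpd ht y
      rw [← hq] at h1
      have h3 : y ⬝ᵥ y = 1 / minEig M T D * (minEig M T D * (y ⬝ᵥ y)) := by
        field_simp
      rw [h3]
      exact mul_le_mul hK.eig h1
        (mul_nonneg hmin.le (dotProduct_self_nonneg' _)) (Nat.cast_nonneg _))
    (by
      simp only [dotProduct_smul, smul_eq_mul, mul_pow]
      rw [← Finset.mul_sum, inv_pow, pow_two, hrr, inv_mul_eq_div]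
      exact div_le_one_of_le₀ hGsum hq0)
  simp only [dotProduct_smul, smul_eq_mul, mul_left_comm _ r⁻¹] at hnoise
  rw [← Finset.mul_sum, inv_mul_eq_div, div_le_iff₀ hrpos, ← hsum] at hnoise
  have hfin : r * r ≤ (6 * T * Real.sqrt (logLevel d K) + oodError M t (D t) (R.V (t + 1)) +
        smoothError M t (D t) (R.V (t + 1))) * r := by
    rw [hrr]; linarith
  exact le_of_mul_le_mul_right hfin hrpos

end Regression

/-! ### Choice of the scale and of the constant -/

section Scale

variable {S A : Type*} [MeasurableSpace S] [MeasurableSpace A] {d : ℕ}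

/-- In dimension zero the linear formula would give the whole state space probability `0`. -/
theorem LinearMDP.one_le_dim (M : LinearMDP S A d) (x : S × A) : 1 ≤ d := by
  by_contra h
  obtain rfl : d = 0 := by omega
  have := M.markov 0
  have h1 := M.P_eq 0 x Set.univ MeasurableSet.univ
  simp at h1

/-- Without any data the covariance would be zero, which is not positive definite in positive
dimension. -/
theorem one_le_num_data (M : LinearMDP S A d) (hd : 1 ≤ d) {T n : ℕ} (hT : 0 < T)
    {D : ℕ → StepData S A} (hn : ∀ t, (D t).samples.length = n)
    (hpd : ∀ t < T, (cov M (D t)).PosDef) :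
    (1 : ℝ) ≤ n + ∑ τ ∈ Finset.range T, ((D τ).ood.length : ℝ) := by
  have h : 1 ≤ n + ∑ τ ∈ Finset.range T, (D τ).ood.length := by
    by_contra hcon
    have h0 : n = 0 ∧ ∑ τ ∈ Finset.range T, (D τ).ood.length = 0 := by omega
    have h1 := Finset.sum_eq_zero_iff.1 h0.2 0 (Finset.mem_range.2 hT)
    have h2 : (D 0).samples = [] := List.length_eq_zero_iff.1 ((hn 0).trans h0.1)
    have h3 : (D 0).ood = [] := List.length_eq_zero_iff.1 h1
    have h4 : cov M (D 0) = 0 := by simp [cov, covIn, covOod, covRobust, h2, h3]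
    have h5 := (hpd 0 hT).dotProduct_mulVec_pos (x := Pi.single ⟨0, hd⟩ 1) (by simp)
    rw [h4] at h5
    simp at h5
  exact_mod_cast h

/-- A power of two that dominates every quantity in the logarithm of the width, and that is
comparable with it. -/
theorem exists_scale (M : LinearMDP S A d) (hd : 1 ≤ d) {T n : ℕ} (hT : 0 < T)
    {D : ℕ → StepData S A} {α : ℕ → ℝ} {ξ : ℝ} (hξ : 0 < ξ) (hξ1 : ξ < 1)
    (hα : ∀ t < T, 0 ≤ α t) (hmin : 0 < minEig M T D)
    (hN : (1 : ℝ) ≤ n + ∑ τ ∈ Finset.range T, ((D τ).ood.length : ℝ)) :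
    ∃ j : ℕ, Dominates M T n D α (2 ^ j) ∧ 2 * (T : ℝ) / ξ ≤ 2 ^ j ∧
      6 * T * Real.sqrt (logLevel d (2 ^ j)) ≤ 60 * d * T * Real.sqrt (Real.log
        (2 * d * T * (n + ∑ τ ∈ Finset.range T, ((D τ).ood.length : ℝ))
          * (1 + ∑ τ ∈ Finset.range T, α τ) * (1 + 1 / minEig M T D) / ξ)) := by
  set N : ℝ := n + ∑ τ ∈ Finset.range T, ((D τ).ood.length : ℝ) with hNdef
  set a : ℝ := 1 + ∑ τ ∈ Finset.range T, α τ with ha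
  set l : ℝ := 1 + 1 / minEig M T D with hl
  set X : ℝ := 2 * d * T * N * a * l / ξ with hX
  have hd1 : (1 : ℝ) ≤ d := by exact_mod_cast hd
  have hT1 : (1 : ℝ) ≤ T := by exact_mod_cast hT
  have ha1 : 1 ≤ a := le_add_of_nonneg_right (Finset.sum_nonneg fun t ht =>
    hα t (Finset.mem_range.1 ht))
  have hl1 : 1 ≤ l := le_add_of_nonneg_right (by positivity)
  have hx1 : 1 ≤ 1 / ξ := by rw [le_div_iff₀ hξ]; linarith
  have mul3 : ∀ x y : ℝ, 1 ≤ x → 1 ≤ y → x ≤ x * y ∧ y ≤ x * y ∧ 1 ≤ x * y := fun x y hx hy =>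
    ⟨by nlinarith, by nlinarith, by nlinarith⟩
  obtain ⟨p1, p2, p3⟩ := mul3 _ _ hT1 hx1
  obtain ⟨q1, q2, q3⟩ := mul3 _ _ hd1 hN
  obtain ⟨r1, r2, r3⟩ := mul3 _ _ ha1 hl1
  obtain ⟨s1, s2, s3⟩ := mul3 _ _ q3 r3
  obtain ⟨u1, u2, u3⟩ := mul3 _ _ p3 s3
  have hXe : X = 2 * (T * (1 / ξ) * (d * N * (a * l))) := by rw [hX]; ring
  have hX2 : 2 ≤ X := by rw [hXe]; linarith
  -- The scale is `2 ^ (j + 1)`, with `2 ^ j ≤ X < 2 ^ (j + 1)`. It exceeds `X`, whose factors other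
  -- than `1/ξ`-type ones are all at least one, and it is at most `2 X ≤ X²`, so its logarithm is at
  -- most `2 log X`.
  obtain ⟨j, hj1, hj2⟩ := exists_nat_pow_near (show 1 ≤ X by linarith) (one_lt_two (α := ℝ))
  have hcast : (((2 ^ (j + 1) : ℕ)) : ℝ) = 2 ^ (j + 1) := by push_cast; ring
  have hK2 : 2 ≤ 2 ^ (j + 1) := by
    have : (2 : ℝ) ≤ 2 ^ (j + 1) := hX2.trans hj2.le
    exact_mod_cast this
  have hood : ∀ t < T, ((D t).ood.length : ℝ) ≤ N := fun t ht => by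
    have := Finset.single_le_sum (f := fun τ => ((D τ).ood.length : ℝ))
      (fun i _ => Nat.cast_nonneg _) (Finset.mem_range.2 ht)
    have h0 : (0 : ℝ) ≤ n := Nat.cast_nonneg n
    linarith
  have hαa : ∀ t < T, α t ≤ a := fun t ht => by
    have := Finset.single_le_sum (f := α)
      (fun i hi => hα i (Finset.mem_range.1 hi)) (Finset.mem_range.2 ht)
    linarith
  have hnN : (n : ℝ) ≤ N := le_add_of_nonneg_right (Finset.sum_nonneg fun _ _ => Nat.cast_nonneg _)
  refine ⟨j + 1, ⟨hK2, ?_, ?_, ?_, fun t ht => ?_, fun t ht => ?_, ?_⟩, ?_, ?_⟩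
  · rw [hcast]; linarith
  · rw [hcast]; linarith
  · rw [hcast]; linarith
  · rw [hcast]; linarith [hood t ht]
  · rw [hcast]; linarith [hαa t ht]
  · rw [hcast]; linarith
  · refine le_trans ?_ hj2.le
    rw [hXe, mul_div_assoc, div_eq_mul_one_div]
    exact mul_le_mul_of_nonneg_left u1 zero_le_two
  · have h1 := logLevel_le hd hK2
    have h2 : Real.log ((2 ^ (j + 1) : ℕ) : ℝ) ≤ 2 * Real.log X := by
      have hX0 : 0 < X := by linarith
      have h3 : Real.log ((2 ^ (j + 1) : ℕ) : ℝ) ≤ Real.log (2 * X) := by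
        refine Real.log_le_log (by positivity) ?_
        rw [hcast, pow_succ]
        linarith
      rw [Real.log_mul two_ne_zero hX0.ne'] at h3
      have := Real.log_le_log two_pos hX2
      linarith
    have hlog : 0 ≤ Real.log X := Real.log_nonneg (by linarith)
    -- Here `44 · 2 = 88 ≤ 10²`; with the factor `6` of the noise bound this produces the constant
    -- `60`.
    have h3 : logLevel d (2 ^ (j + 1)) ≤ (10 * d) ^ 2 * Real.log X := by
      refine h1.trans ?_
      have h4 := mul_le_mul_of_nonneg_left h2 (by positivity : (0 : ℝ) ≤ 44 * (d : ℝ) ^ 2)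
      nlinarith [mul_nonneg (sq_nonneg (d : ℝ)) hlog]
    have h4 := Real.sqrt_le_sqrt h3
    rw [Real.sqrt_mul (sq_nonneg _), Real.sqrt_sq (by positivity)] at h4
    calc 6 * (T : ℝ) * Real.sqrt (logLevel d (2 ^ (j + 1)))
        ≤ 6 * T * (10 * d * Real.sqrt (Real.log X)) := by gcongr
      _ = 60 * d * T * Real.sqrt (Real.log X) := by ring

omit [MeasurableSpace S] [MeasurableSpace A] in
theorem mkData_union (m k : ℕ) (z : ℕ → S × A × S) (adv : ℕ → List S)
    (ood ood' : List (S × A × ℝ)) :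
    (mkData (List.range m) z adv ood).union (mkData (List.range' m k) z adv ood') =
      mkData (List.range (m + k)) z adv (ood ++ ood') := by
  unfold StepData.union mkData
  simp only [← List.map_append, List.range_eq_range']
  have h := List.range'_append (s := 0) (m := m) (n := k) (step := 1)
  rw [zero_add, one_mul] at h
  rw [h]

theorem oodError_le_width (M : LinearMDP S A d) (T n : ℕ) (ξ : ℝ) (D : ℕ → StepData S A)
    (α : ℕ → ℝ) (t : ℕ) (V : S → ℝ) :
    oodError M t (D t) V ≤ width 60 M T n ξ D α t V := by
  have h1 : 0 ≤ smoothError M t (D t) V := Real.sqrt_nonneg _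
  unfold width
  have h2 : 0 ≤ 60 * (d : ℝ) * T * Real.sqrt (Real.log
      (2 * d * T * (n + ∑ τ ∈ Finset.range T, ((D τ).ood.length : ℝ))
        * (1 + ∑ τ ∈ Finset.range T, α τ) * (1 + 1 / minEig M T D) / ξ)) := by positivity
  linarith

end Scale

end RO2O

end

/-! ### The main theorem -/

theorem theorem2 : ∃ c : ℝ, 0 < c ∧
    ∀ (S A Ω : Type*) [MeasurableSpace S] [MeasurableSpace A] [MeasurableSpace Ω]
      (Pr : Measure Ω) [IsProbabilityMeasure Pr] (d T m k : ℕ) (M : RO2O.LinearMDP S A d)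
      (Z : ℕ → ℕ → Ω → S × A × S) (_ : RO2O.Collected M Pr T (m + k) Z)
      (ξ : ℝ) (_ : 0 < ξ) (_ : ξ < 1),
    ∃ E : Set Ω, MeasurableSet E ∧ 1 - ξ ≤ Pr.real E ∧
      ∀ (ω : Ω) (adv : ℕ → ℕ → List S) (oodOffline oodOnline : ℕ → List (S × A × ℝ))
        (Doffline Donline Dtotal : ℕ → RO2O.StepData S A)
        (_ : ∀ t, Doffline t =
          RO2O.mkData (List.range m) (fun i => Z t i ω) (adv t) (oodOffline t))
        (_ : ∀ t, Donline t =
          RO2O.mkData (List.range' m k) (fun i => Z t i ω) (adv t) (oodOnline t))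
        (_ : ∀ t, Dtotal t = (Doffline t).union (Donline t))
        (_ : ∀ t < T, (RO2O.cov M (Doffline t)).PosDef)
        (β : ℕ → ℝ) (ρ : Measure S) [IsProbabilityMeasure ρ]
        (πstar : ℕ → Kernel S A) [∀ t, IsMarkovKernel (πstar t)],
        (∀ (α : ℕ → ℝ) (R : RO2O.Run M T Dtotal α), ω ∈ E →
          (∀ t < T,
            RO2O.width c M T (m + k) ξ Dtotal α t (R.V (t + 1)) ≤ α t ∧
            α t + RO2O.width c M T (m + k) ξ Dtotal α t (R.V (t + 1)) ≤ β t) →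
          RO2O.subOpt M T πstar R.policy ρ ≤
            ∑ t ∈ Finset.range T, RO2O.expect M πstar ρ t (RO2O.lcb M (β t) (Dtotal t))) ∧
        ((∀ t < T, 0 ≤ β t) →
          ∑ t ∈ Finset.range T, RO2O.expect M πstar ρ t (RO2O.lcb M (β t) (Dtotal t)) ≤
            ∑ t ∈ Finset.range T, RO2O.expect M πstar ρ t (RO2O.lcb M (β t) (Doffline t))) := by
  refine ⟨60, by norm_num, ?_⟩
  intro S A Ω _ _ _ Pr _ d T m k M Z hZ ξ hξ hξ1
  obtain ⟨E, hEm, hEp, hE⟩ := RO2O.exists_good_event hZ hξ hξ1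
  refine ⟨E, hEm, hEp, ?_⟩
  intro ω adv oodOffline oodOnline Doffline Donline Dtotal hoff hon htot hpd β ρ _ πstar _
  refine ⟨fun α R hω hwidth => ?_, fun hβ => ?_⟩
  swap
  · simp only [htot]
    exact RO2O.sum_expect_lcb_union_le M T πstar ρ hβ Doffline Donline hpd
  have hpdt : ∀ t < T, (RO2O.cov M (Dtotal t)).PosDef := fun t ht => by
    rw [htot]
    exact RO2O.cov_union_posDef M (hpd t ht) _
  -- Offline and online transitions have consecutive indices, so the union is one data set of `m +
  -- k` transitions.
  have hD : ∀ t, Dtotal t = RO2O.mkData (List.range (m + k)) (fun i => Z t i ω) (adv t)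
      (oodOffline t ++ oodOnline t) := fun t => by
    rw [htot, hoff, hon, RO2O.mkData_union]
  obtain ⟨s⟩ : Nonempty S := ρ.nonempty_of_neZero
  have hood : ∀ t < T, RO2O.oodError M t (Dtotal t) (R.V (t + 1)) ≤ α t := fun t ht =>
    (RO2O.oodError_le_width M T (m + k) ξ Dtotal α t _).trans (hwidth t ht).1
  -- Nonnegativity of the coefficients is implied: they dominate the width, hence the OOD error.
  have hα : ∀ t < T, 0 ≤ α t := fun t ht => (Real.sqrt_nonneg _).trans (hood t ht)
  refine RO2O.subOpt_le R πstar ρ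
    (fun t => RO2O.width 60 M T (m + k) ξ Dtotal α t (R.V (t + 1))) β
    (fun t ht => (hwidth t ht).1) (fun t ht => (hwidth t ht).2) fun t ht x => ?_
  have hd := M.one_le_dim x
  have hT := Nat.zero_lt_of_lt ht
  have : Nonempty (Fin d) := ⟨⟨0, hd⟩⟩
  have hN := RO2O.one_le_num_data M hd hT (n := m + k) (D := Dtotal)
    (fun t => by rw [hD]; simp [RO2O.mkData]) hpdt
  obtain ⟨j, hdom, hj, hlevel⟩ := RO2O.exists_scale M hd hT hξ hξ1 hα
    (RO2O.minEig_pos M hT Dtotal hpdt) hN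
  refine (RO2O.abs_regression_error_le hd hD R hdom hpdt hood ht
    (hE ω hω j hj t ht) x).trans ?_
  refine mul_le_mul_of_nonneg_right ?_ (RO2O.uncertainty_nonneg M _ x)
  exact add_le_add (add_le_add hlevel le_rfl) le_rfl
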